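/- Let $M$ be a compact connected complex manifold of dimension $m$, let $N$ be a complex manifold of dimension $n$, and let $f:M\to N$ be a holomorphic map. Let $\pi:\mathbb P(T_M)\to M$ be the projective bundle whose points are the pairs $(p,\ell)$ with $p\in M$ and $\ell$ a complex line through the origin in the holomorphic tangent space $T_pM$, and let $\mathcal O_{T_M^*}(-1)\subset\pi^*T_M$ be its tautological line bundle, whose fibre over $(p,\ell)$ is $\ell$. Suppose that (1) $\mathcal O_{T_M^*}(-1)$ is RC-positive, that is, it admits a smooth Hermitian metric $h$ whose Chern curvature $-\sqrt{-1}\,\partial\bar\partial\log h$ has at least one positive eigenvalue at every point of $\mathbb P(T_M)$; and (2) $N$ admits a smooth Hermitian metric $g$ of non-positive holomorphic bisectional curvature, that is, the curvature tensor of its Chern connection, $$R_{k\bar l i\bar j}=-\frac{\partial^2 g_{i\bar j}}{\partial z^k\partial\bar z^l}+g^{p\bar q}\,\frac{\partial g_{i\bar q}}{\partial z^k}\,\frac{\partial g_{p\bar j}}{\partial\bar z^l},$$ satisfies $R_{k\bar l i\bar j}\,u^k\bar u^l v^i\bar v^j\le 0$ for all holomorphic tangent vectors $u,v$ of $N$ at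 the same point. Then $f$ is a constant map. -/

import Mathlib

open scoped Manifold ContDiff

noncomputable section

namespace RCPositivity

/-! ## Wirtinger derivatives on `ℂ^ι` -/

section Wirtinger

variable {ι : Type*} [Fintype ι] [DecidableEq ι]

/-- The Wirtinger derivative `∂F/∂z^a = (∂F/∂x^a - i ∂F/∂y^a) / 2`, where `z^a = x^a + i y^a`. -/
def wirtinger (a : ι) (F : EuclideanSpace ℂ ι → ℂ) (z : EuclideanSpace ℂ ι) : ℂ :=
  (fderiv ℝ F z (EuclideanSpace.single a 1)
    - Complex.I * fderiv ℝ F z (EuclideanSpace.single a Complex.I)) / 2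

/-- The conjugate Wirtinger derivative `∂F/∂z̄^a = (∂F/∂x^a + i ∂F/∂y^a) / 2`. -/
def wirtingerBar (a : ι) (F : EuclideanSpace ℂ ι → ℂ) (z : EuclideanSpace ℂ ι) : ℂ :=
  (fderiv ℝ F z (EuclideanSpace.single a 1)
    + Complex.I * fderiv ℝ F z (EuclideanSpace.single a Complex.I)) / 2

end Wirtinger

/-! ## Hermitian metrics on a complex manifold and their Chern curvature

A complex manifold of dimension `n` is a space with an atlas of charts in `ℂ^n` with holomorphic
transition maps. The holomorphic tangent space at `q` is the complex vector space
`TangentSpace 𝓘(ℂ, ℂ^n) q`. -/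

section Hermitian

variable {n : ℕ} {N : Type*} [TopologicalSpace N] [ChartedSpace (EuclideanSpace ℂ (Fin n)) N]

/-- The tangent vector `v^i ∂/∂z^i` at the point with coordinates `z` in the chart `φ`. -/
def coordVector (φ : OpenPartialHomeomorph N (EuclideanSpace ℂ (Fin n)))
    (z v : EuclideanSpace ℂ (Fin n)) :
    TangentSpace 𝓘(ℂ, EuclideanSpace ℂ (Fin n)) (φ.symm z) :=
  mfderiv 𝓘(ℂ, EuclideanSpace ℂ (Fin n)) 𝓘(ℂ, EuclideanSpace ℂ (Fin n)) φ.symm z v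

/-- The matrix `(g_{i j̄})`, `g_{i j̄} = g(∂/∂z^i, ∂/∂z^j)`, of a family of Hermitian inner products
in the chart `φ`; it is linear in the index `i` and conjugate linear in `j` (Mathlib's inner
products are conjugate linear in the first argument). -/
def metricMatrix
    (g : ∀ q : N, InnerProductSpace.Core ℂ (TangentSpace 𝓘(ℂ, EuclideanSpace ℂ (Fin n)) q))
    (φ : OpenPartialHomeomorph N (EuclideanSpace ℂ (Fin n))) (z : EuclideanSpace ℂ (Fin n)) :
    Matrix (Fin n) (Fin n) ℂ :=
  Matrix.of fun i j => (g (φ.symm z)).inner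
    (coordVector φ z (EuclideanSpace.single j 1)) (coordVector φ z (EuclideanSpace.single i 1))

variable (n N) in
/-- A smooth Hermitian metric on (the holomorphic tangent bundle of) the complex manifold `N`. -/
structure HermitianMetric where
  /-- the Hermitian inner product on each holomorphic tangent space -/
  core : ∀ q : N, InnerProductSpace.Core ℂ (TangentSpace 𝓘(ℂ, EuclideanSpace ℂ (Fin n)) q)
  /-- the coefficients `g_{i j̄}` are smooth in every chart -/
  smooth : ∀ φ ∈ atlas (EuclideanSpace ℂ (Fin n)) N, ∀ i j : Fin n,
    ContDiffOn ℝ ∞ (fun z => metricMatrix core φ z i j) φ.target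

/-- The coefficients of the Chern curvature tensor of `(N, g)` in the chart `φ`:
`R_{k l̄ i j̄} = - ∂²g_{i j̄}/∂z^k∂z̄^l + g^{p q̄} (∂g_{i q̄}/∂z^k) (∂g_{p j̄}/∂z̄^l)`.
Here `g^{p q̄}` is the `(q, p)` entry of the inverse of the matrix `(g_{i j̄})`. -/
def HermitianMetric.chernCurvature (g : HermitianMetric n N)
    (φ : OpenPartialHomeomorph N (EuclideanSpace ℂ (Fin n))) (z : EuclideanSpace ℂ (Fin n))
    (k l i j : Fin n) : ℂ :=
  - wirtinger k (wirtingerBar l fun x => metricMatrix g.core φ x i j) z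
    + ∑ p, ∑ q, (metricMatrix g.core φ z)⁻¹ q p
        * wirtinger k (fun x => metricMatrix g.core φ x i q) z
        * wirtingerBar l (fun x => metricMatrix g.core φ x p j) z

/-- `(N, g)` has non-positive holomorphic bisectional curvature: `R(u, ū, v, v̄) ≤ 0` for all
holomorphic tangent vectors `u = u^k ∂/∂z^k`, `v = v^i ∂/∂z^i` at the same point. (The number
`R(u, ū, v, v̄)` is always real.) -/
def HermitianMetric.NonposBisectionalCurvature (g : HermitianMetric n N) : Prop :=
  ∀ φ ∈ atlas (EuclideanSpace ℂ (Fin n)) N, ∀ z ∈ φ.target, ∀ u v : Fin n → ℂ,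
    (∑ k, ∑ l, ∑ i, ∑ j, g.chernCurvature φ z k l i j
      * u k * starRingEnd ℂ (u l) * v i * starRingEnd ℂ (v j)).re ≤ 0

end Hermitian

/-! ## The projective bundle `P(T_M)` and its tautological line bundle `O_{T*_M}(-1)` -/

section Tautological

variable {m : ℕ} {M : Type*} [TopologicalSpace M] [ChartedSpace (EuclideanSpace ℂ (Fin m)) M]

variable (m M) in
/-- The projective bundle `P(T_M) → M`: its points are the pairs `(p, ℓ)` of a point `p` of `M` and
a complex line `ℓ` through the origin of the holomorphic tangent space `T_p M`. -/
abbrev ProjTangentBundle : Type _ :=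
  Σ p : M, Projectivization ℂ (TangentSpace 𝓘(ℂ, EuclideanSpace ℂ (Fin m)) p)

/-- The fibre of the tautological line bundle `O_{T*_M}(-1) ⊆ π^* T_M` at `(p, ℓ)`: the line `ℓ`
itself. -/
abbrev TautFibre (x : ProjTangentBundle m M) :
    Submodule ℂ (TangentSpace 𝓘(ℂ, EuclideanSpace ℂ (Fin m)) x.1) :=
  x.2.submodule

/-- The squared length `h(W, W)` of a tangent vector `W`, as an element of the fibre of
`O_{T*_M}(-1)` at the point `[W]` of `P(T_M)`, for a family `h` of Hermitian inner products on these
fibres. -/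
def tautNormSq (h : ∀ x : ProjTangentBundle m M, InnerProductSpace.Core ℂ (TautFibre x))
    (p : M) (W : TangentSpace 𝓘(ℂ, EuclideanSpace ℂ (Fin m)) p) : ℝ :=
  open Classical in
  if hW : W ≠ 0 then
    ((h ⟨p, Projectivization.mk ℂ W hW⟩).inner
      (⟨W, Submodule.mem_span_singleton_self W⟩ : ℂ ∙ W)
      (⟨W, Submodule.mem_span_singleton_self W⟩ : ℂ ∙ W)).re
  else 0

/-- Index set of the holomorphic coordinates `(z^1, …, z^m, w^k (k ≠ j))` on the open subset
`W^j ≠ 0` of `P(T_M)` over a chart of `M`. Here `W^1, …, W^m` are the fibre coordinates of `T_M`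
given by the chart, and `w^k = W^k / W^j`. -/
abbrev ProjIndex (j : Fin m) : Type := Fin m ⊕ {k : Fin m // k ≠ j}

/-- The base coordinates `(z^1, …, z^m)` of `ζ = (z, w)`. -/
def baseCoord {j : Fin m} (ζ : EuclideanSpace ℂ (ProjIndex j)) : EuclideanSpace ℂ (Fin m) :=
  WithLp.toLp 2 fun α => ζ (Sum.inl α)

/-- The components `W^j = 1`, `W^k = w^k` for `k ≠ j` of the normalized representative of the point
with coordinates `ζ = (z, w)`. -/
def affineCoord {j : Fin m} (ζ : EuclideanSpace ℂ (ProjIndex j)) : EuclideanSpace ℂ (Fin m) :=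
  WithLp.toLp 2 fun k => if hk : k = j then 1 else ζ (Sum.inr ⟨k, hk⟩)

/-- The squared length `h(s, s)` of the local holomorphic frame
`s(z, w) = ∂/∂z^j + ∑_{k ≠ j} w^k ∂/∂z^k` of `O_{T*_M}(-1)` over the set `W^j ≠ 0` in `P(T_M)`, in
the holomorphic coordinates `ζ = (z, w)` of that set. -/
def tautWeight (h : ∀ x : ProjTangentBundle m M, InnerProductSpace.Core ℂ (TautFibre x))
    (φ : OpenPartialHomeomorph M (EuclideanSpace ℂ (Fin m))) (j : Fin m)
    (ζ : EuclideanSpace ℂ (ProjIndex j)) : ℝ :=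
  tautNormSq h (φ.symm (baseCoord ζ)) (coordVector φ (baseCoord ζ) (affineCoord ζ))

variable (m M) in
/-- A smooth Hermitian metric on the tautological line bundle `O_{T*_M}(-1)` over `P(T_M)`. -/
structure TautHermitianMetric where
  /-- the Hermitian inner product on each fibre -/
  core : ∀ x : ProjTangentBundle m M, InnerProductSpace.Core ℂ (TautFibre x)
  /-- smoothness, in the local holomorphic coordinates and frames -/
  smooth : ∀ φ ∈ atlas (EuclideanSpace ℂ (Fin m)) M, ∀ j : Fin m,
    ContDiffOn ℝ ∞ (tautWeight core φ j) {ζ | baseCoord ζ ∈ φ.target}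

/-- The coefficient matrix `- ∂² log h(s, s) / ∂ζ^a ∂ζ̄^b` of the Chern curvature form
`- √-1 ∂∂̄ log h` of `(O_{T*_M}(-1), h)` in the local holomorphic coordinates `ζ` of `P(T_M)`. -/
def TautHermitianMetric.curvatureMatrix (h : TautHermitianMetric m M)
    (φ : OpenPartialHomeomorph M (EuclideanSpace ℂ (Fin m))) (j : Fin m)
    (ζ : EuclideanSpace ℂ (ProjIndex j)) : Matrix (ProjIndex j) (ProjIndex j) ℂ :=
  Matrix.of fun a b =>
    - wirtinger a (wirtingerBar b fun ξ => (Real.log (tautWeight h.core φ j ξ) : ℂ)) ζ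

variable (m M) in
/-- `O_{T*_M}(-1)` is RC-positive: it admits a smooth Hermitian metric whose Chern curvature has at
least one positive eigenvalue at every point of `P(T_M)`. -/
def TautRCPositive : Prop :=
  ∃ h : TautHermitianMetric m M,
    ∀ φ ∈ atlas (EuclideanSpace ℂ (Fin m)) M, ∀ (j : Fin m) (ζ : EuclideanSpace ℂ (ProjIndex j)),
      baseCoord ζ ∈ φ.target →
        ∃ μ : ℝ, 0 < μ ∧
          Module.End.HasEigenvalue (Matrix.toLin' (h.curvatureMatrix φ j ζ)) (μ : ℂ)

end Tautological

end RCPositivity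

end

/-!
# Rigidity of holomorphic maps out of manifolds with RC-positive tautological bundle

Suppose that `f` is not constant. The ratio `u(p, [W]) = |df(W)|²_g / h(W, W)` is a well-defined
continuous function on the compact space `P(T_M)` and is positive somewhere, so it has a positive
maximum (`exists_forall_energyRatio_le`). In holomorphic coordinates `ζ` of `P(T_M)` near the
maximum, `log u = log G - log h(s, s)`, where `G` is the squared length of `df(s)`, a holomorphic
section of the pull-back of `T_N`. Along every complex line in the coordinates, non-positive
bisectional curvature makes `log G` subharmonic at the maximum
(`exists_wirtinger_curveNormSq`): `∂∂̄G = |∇V|² - R(u, ū, V, V̄)` and `∂G = ⟨∇V, V⟩`, so the claim is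
the Cauchy-Schwarz inequality (`curvature_algebra`). RC-positivity gives a line through the maximum
along which `-∂∂̄ log h(s, s) > 0`. Hence `∂∂̄ log u > 0` along this line, contrary to the maximum
principle (`re_nonneg_of_isLocalMax_mul_exp`). Thus `df = 0`, and `f` is constant because `M` is
connected.

All second derivatives are taken along holomorphic curves, with functions of one complex variable;
`HasWirtingerAt F a b t` records both Wirtinger derivatives of `F` at `t`, and
`hasWirtingerAt_wirtingerBar_comp_curve` relates them to the derivatives in several variables that
define the curvatures.
-/

noncomputable section

namespace RCPositivity

open Filter Topology ComplexConjugate Matrix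

/-! ### Wirtinger calculus in one complex variable -/

/-- The real-linear map `s ↦ a s + b s̄` of `ℂ`. -/
def wirtingerCLM (a b : ℂ) : ℂ →L[ℝ] ℂ :=
  a • ContinuousLinearMap.id ℝ ℂ + b • (Complex.conjCLE : ℂ →L[ℝ] ℂ)

@[simp]
lemma wirtingerCLM_apply (a b s : ℂ) : wirtingerCLM a b s = a * s + b * conj s := by
  simp [wirtingerCLM]

/-- `F` is real differentiable at `t` with `∂F/∂t = a` and `∂F/∂t̄ = b`. -/
def HasWirtingerAt (F : ℂ → ℂ) (a b t : ℂ) : Prop :=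
  HasFDerivAt F (wirtingerCLM a b) t

namespace HasWirtingerAt

variable {F G : ℂ → ℂ} {a b c d t : ℂ}

lemma unique (hF : HasWirtingerAt F a b t) (hF' : HasWirtingerAt F c d t) : a = c ∧ b = d := by
  have h := HasFDerivAt.unique hF hF'
  have h1 := congrArg (fun L : ℂ →L[ℝ] ℂ => L 1) h
  have h2 := congrArg (fun L : ℂ →L[ℝ] ℂ => L Complex.I) h
  simp only [wirtingerCLM_apply, map_one, mul_one, Complex.conj_I] at h1 h2
  have h3 : a - b = c - d := by
    apply mul_right_cancel₀ Complex.I_ne_zero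
    linear_combination h2
  constructor
  · linear_combination (h1 + h3) / 2
  · linear_combination (h1 - h3) / 2

lemma congr_of_eventuallyEq (hF : HasWirtingerAt F a b t) (h : G =ᶠ[𝓝 t] F) :
    HasWirtingerAt G a b t :=
  HasFDerivAt.congr_of_eventuallyEq hF h

lemma congr_wirtinger (hF : HasWirtingerAt F a b t) (hac : a = c) (hbd : b = d) :
    HasWirtingerAt F c d t := by
  rwa [← hac, ← hbd]

lemma add (hF : HasWirtingerAt F a b t) (hG : HasWirtingerAt G c d t) :
    HasWirtingerAt (fun s => F s + G s) (a + c) (b + d) t := by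
  refine (HasFDerivAt.add hF hG).congr_fderiv ?_
  refine ContinuousLinearMap.ext fun s => ?_
  simp
  ring

lemma sum {ι : Type*} {s : Finset ι} {F : ι → ℂ → ℂ} {a b : ι → ℂ}
    (h : ∀ i ∈ s, HasWirtingerAt (F i) (a i) (b i) t) :
    HasWirtingerAt (fun x => ∑ i ∈ s, F i x) (∑ i ∈ s, a i) (∑ i ∈ s, b i) t := by
  refine (HasFDerivAt.fun_sum h).congr_fderiv ?_
  refine ContinuousLinearMap.ext fun s => ?_
  simp [Finset.sum_add_distrib, Finset.sum_mul]

lemma mul (hF : HasWirtingerAt F a b t) (hG : HasWirtingerAt G c d t) :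
    HasWirtingerAt (fun s => F s * G s) (a * G t + F t * c) (b * G t + F t * d) t := by
  refine (HasFDerivAt.mul hF hG).congr_fderiv ?_
  refine ContinuousLinearMap.ext fun s => ?_
  simp
  ring

protected lemma star (hF : HasWirtingerAt F a b t) :
    HasWirtingerAt (fun s => conj (F s)) (conj b) (conj a) t := by
  refine ((Complex.conjCLE : ℂ →L[ℝ] ℂ).hasFDerivAt.comp t hF).congr_fderiv ?_
  refine ContinuousLinearMap.ext fun s => ?_
  simp
  ring

end HasWirtingerAt

lemma hasWirtingerAt_of_hasDerivAt {F : ℂ → ℂ} {a t : ℂ} (hF : HasDerivAt F a t) :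
    HasWirtingerAt F a 0 t := by
  refine (hF.hasFDerivAt.restrictScalars ℝ).congr_fderiv ?_
  refine ContinuousLinearMap.ext fun s => ?_
  simp
  ring

lemma HasWirtingerAt.holomorphic_comp {Φ F : ℂ → ℂ} {a b c t : ℂ}
    (hΦ : HasDerivAt Φ c (F t)) (hF : HasWirtingerAt F a b t) :
    HasWirtingerAt (fun s => Φ (F s)) (c * a) (c * b) t := by
  refine (HasFDerivAt.comp t (hΦ.hasFDerivAt.restrictScalars ℝ) hF).congr_fderiv ?_
  refine ContinuousLinearMap.ext fun s => ?_
  simp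
  ring

/-! ### Wirtinger derivatives along holomorphic curves -/

section Curve

variable {ι : Type*} [Fintype ι] [DecidableEq ι]

lemma realLinear_apply_eq_sum (L : EuclideanSpace ℂ ι →L[ℝ] ℂ) (u : EuclideanSpace ℂ ι) :
    L u = ∑ k, (u k * ((L (EuclideanSpace.single k 1)
        - Complex.I * L (EuclideanSpace.single k Complex.I)) / 2)
      + conj (u k) * ((L (EuclideanSpace.single k 1)
        + Complex.I * L (EuclideanSpace.single k Complex.I)) / 2)) := by
  have hu : u = ∑ k, ((u k).re • EuclideanSpace.single k (1 : ℂ)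
      + (u k).im • EuclideanSpace.single k Complex.I) := by
    ext i
    simp [Finset.sum_apply, Pi.single_apply, Finset.sum_add_distrib]
  conv_lhs => rw [hu]
  rw [map_sum]
  refine Finset.sum_congr rfl fun k _ => ?_
  rw [map_add, map_smul, map_smul, Complex.real_smul, Complex.real_smul]
  have h1 : conj (u k) = (u k).re - (u k).im * Complex.I := by
    simp [Complex.ext_iff]
  have h2 := (Complex.re_add_im (u k)).symm
  rw [h1]
  nth_rewrite 3 [h2]
  linear_combination ((u k).im * L (EuclideanSpace.single k Complex.I)) * Complex.I_sq

lemma hasWirtingerAt_comp_curve {F : EuclideanSpace ℂ ι → ℂ} {y : ℂ → EuclideanSpace ℂ ι}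
    {y' : EuclideanSpace ℂ ι} {t : ℂ} (hF : DifferentiableAt ℝ F (y t)) (hy : HasDerivAt y y' t) :
    HasWirtingerAt (fun s => F (y s)) (∑ k, y' k * wirtinger k F (y t))
      (∑ k, conj (y' k) * wirtingerBar k F (y t)) t := by
  refine (hF.hasFDerivAt.comp t (hy.hasFDerivAt.restrictScalars ℝ)).congr_fderiv ?_
  refine ContinuousLinearMap.ext fun s => ?_
  rw [ContinuousLinearMap.comp_apply, realLinear_apply_eq_sum, wirtingerCLM_apply, Finset.sum_mul,
    Finset.sum_mul, ← Finset.sum_add_distrib]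
  refine Finset.sum_congr rfl fun k _ => ?_
  simp [wirtinger, wirtingerBar]
  ring

/-- The mixed second derivative `∂²/∂t∂t̄` along a holomorphic curve `y` sees only the velocity
of `y`, through the complex Hessian of `F`. -/
lemma hasWirtingerAt_wirtingerBar_comp_curve {F : EuclideanSpace ℂ ι → ℂ}
    {y y' : ℂ → EuclideanSpace ℂ ι} {y'' : EuclideanSpace ℂ ι} {t : ℂ}
    (hF : ContDiffAt ℝ 2 F (y t)) (hy : HasDerivAt y (y' t) t) (hy' : HasDerivAt y' y'' t) :
    ∃ d, HasWirtingerAt (fun s => ∑ l, conj (y' s l) * wirtingerBar l F (y s))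
      (∑ k, ∑ l, wirtinger k (wirtingerBar l F) (y t) * y' t k * conj (y' t l)) d t := by
  have hdF : DifferentiableAt ℝ (fderiv ℝ F) (y t) :=
    (hF.fderiv_right (m := 1) (by norm_num)).differentiableAt (by norm_num)
  have hbar : ∀ l, DifferentiableAt ℝ (wirtingerBar l F) (y t) := fun l => by
    unfold wirtingerBar
    fun_prop
  have hy'l : ∀ l, HasDerivAt (fun s => y' s l) (y'' l) t := fun l =>
    (EuclideanSpace.proj (𝕜 := ℂ) l).hasFDerivAt.comp_hasDerivAt t hy'
  refine ⟨_, (HasWirtingerAt.sum fun l _ => ((hasWirtingerAt_of_hasDerivAt (hy'l l)).star.mul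
    (hasWirtingerAt_comp_curve (hbar l) hy))).congr_wirtinger ?_ rfl⟩
  rw [Finset.sum_comm]
  refine Finset.sum_congr rfl fun l _ => ?_
  simp only [map_zero, zero_mul, zero_add, Finset.mul_sum]
  exact Finset.sum_congr rfl fun k _ => by ring

/-- First Wirtinger derivatives of `F` along a holomorphic curve, near a point where `F` is
twice differentiable. -/
lemma eventually_hasWirtingerAt_comp_curve {F : EuclideanSpace ℂ ι → ℂ}
    {y y' : ℂ → EuclideanSpace ℂ ι} {t : ℂ}
    (hF : ContDiffAt ℝ 2 F (y t)) (hy : ∀ᶠ s in 𝓝 t, HasDerivAt y (y' s) s) :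
    ∀ᶠ s in 𝓝 t, HasWirtingerAt (fun s => F (y s)) (∑ k, y' s k * wirtinger k F (y s))
      (∑ k, conj (y' s k) * wirtingerBar k F (y s)) s := by
  have h := hy.self_of_nhds.continuousAt.eventually (hF.eventually (by simp))
  filter_upwards [h, hy] with s hs hys
  exact hasWirtingerAt_comp_curve (hs.differentiableAt (by norm_num)) hys

end Curve

/-! ### The maximum principle along a complex line -/

lemma deriv_deriv_nonpos_of_isLocalMax {f : ℝ → ℝ} {x : ℝ} (h : IsLocalMax f x)
    (hc : ContinuousAt f x) : deriv (deriv f) x ≤ 0 := by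
  by_contra! hpos
  have hmin := isLocalMin_of_deriv_deriv_pos hpos h.deriv_eq_zero hc
  have hconst : f =ᶠ[𝓝 x] fun _ => f x := by
    filter_upwards [h, hmin] with y h1 h2 using le_antisymm h1 h2
  have h2 : deriv f =ᶠ[𝓝 x] fun _ => 0 := by
    filter_upwards [hconst.eventuallyEq_nhds] with y hy
    rw [hy.deriv_eq, deriv_const]
  rw [h2.deriv_eq, deriv_const] at hpos
  exact lt_irrefl _ hpos

/-- At a local maximum of a real function `p` of one complex variable the first derivatives vanish
and `∂²p/∂t∂t̄ ≤ 0`. -/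
lemma wirtinger_of_isLocalMax {p : ℂ → ℝ} {a b : ℂ → ℂ} {c d t : ℂ} (hmax : IsLocalMax p t)
    (hp : ∀ᶠ s in 𝓝 t, HasWirtingerAt (fun s => (p s : ℂ)) (a s) (b s) s)
    (hb : HasWirtingerAt b c d t) : a t = 0 ∧ b t = 0 ∧ c.re ≤ 0 := by
  have hre : ∀ s, HasWirtingerAt (fun s => (p s : ℂ)) (a s) (b s) s →
      HasFDerivAt p (Complex.reCLM.comp (wirtingerCLM (a s) (b s))) s := fun s hs =>
    (Complex.reCLM.hasFDerivAt.comp s hs :)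
  -- Since `p` is real, `∂p/∂t` is the conjugate of `∂p/∂t̄`.
  have hab : ∀ᶠ s in 𝓝 t, a s = conj (b s) := by
    filter_upwards [hp] with s hs
    exact (hs.unique (by simpa using hs.star)).1
  have h0 := hmax.hasFDerivAt_eq_zero (hre t hp.self_of_nhds)
  have hb0 : b t = 0 := by
    have h1 := congrArg (fun L : ℂ →L[ℝ] ℝ => L 1) h0
    have h2 := congrArg (fun L : ℂ →L[ℝ] ℝ => L Complex.I) h0
    simp [hab.self_of_nhds] at h1 h2
    apply Complex.ext
    all_goals
      simp
      linarith
  refine ⟨by rw [hab.self_of_nhds, hb0, map_zero], hb0, ?_⟩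
  -- The second derivative of `p` along the real line through `t` with direction `v`.
  have key : ∀ v : ℂ, (2 * (c * v + d * conj v) * conj v).re ≤ 0 := fun v => by
    have hline : ∀ r : ℝ, HasDerivAt (fun r : ℝ => t + r * v) v r := fun r => by
      simpa using ((hasDerivAt_id r).ofReal_comp.mul_const v).const_add t
    have hcont : Tendsto (fun r : ℝ => t + r * v) (𝓝 0) (𝓝 t) := by
      simpa using (hline 0).continuousAt.tendsto
    have hmax' : IsLocalMax (fun r : ℝ => p (t + r * v)) 0 := by
      have := hcont.eventually hmax
      simpa [IsLocalMax, IsMaxFilter] using this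
    have hd1 : deriv (fun r : ℝ => p (t + r * v)) =ᶠ[𝓝 0]
        fun r : ℝ => (2 * b (t + r * v) * conj v).re := by
      filter_upwards [hcont.eventually hp, hcont.eventually hab] with r hr hr'
      have h1 : HasDerivAt (fun r : ℝ => p (t + r * v)) _ r :=
        (hre _ hr).comp_hasDerivAt r (hline r)
      rw [h1.deriv]
      simp [hr']
      ring
    have hb' : HasFDerivAt b (wirtingerCLM c d) (t + (0 : ℝ) * v) := by
      rw [Complex.ofReal_zero, zero_mul, add_zero]
      exact hb
    have hd2 : HasDerivAt (fun r : ℝ => (2 * b (t + r * v) * conj v).re)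
        (2 * (c * v + d * conj v) * conj v).re 0 := by
      have h1 := hb'.comp_hasDerivAt (0 : ℝ) (hline 0)
      have h2 := (h1.const_mul 2).mul_const (conj v)
      have h3 := Complex.reCLM.hasFDerivAt.comp_hasDerivAt (0 : ℝ) h2
      simpa only [wirtingerCLM_apply] using! h3
    have hcp : ContinuousAt (fun r : ℝ => p (t + r * v)) 0 := by
      refine ContinuousAt.comp (f := fun r : ℝ => t + r * v) ?_ (hline 0).continuousAt
      simpa using (hre t hp.self_of_nhds).continuousAt
    have := deriv_deriv_nonpos_of_isLocalMax hmax' hcp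
    rwa [hd1.deriv_eq, hd2.deriv] at this
  have k1 := key 1
  have k2 := key Complex.I
  simp at k1 k2
  linarith

/-! ### Curvature and the logarithmic Hessian of the length of a section -/

section Algebra

variable {ι : Type*} [Fintype ι] {a : Matrix ι ι ℂ}

lemma star_dotProduct_mulVec_star (a : Matrix ι ι ℂ) (v w : ι → ℂ) :
    star (v ⬝ᵥ a *ᵥ star w) = w ⬝ᵥ aᴴ *ᵥ star v := by
  rw [← star_dotProduct_star, star_mulVec, star_star, dotProduct_comm, dotProduct_mulVec,
    dotProduct_comm, dotProduct_comm _ (star v)]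

lemma dotProduct_mulVec_star_im (ha : a.IsHermitian) (w : ι → ℂ) :
    (w ⬝ᵥ a *ᵥ star w).im = 0 := by
  have h := star_dotProduct_mulVec_star a w w
  rw [ha.eq] at h
  exact Complex.conj_eq_iff_im.1 h

lemma hermitian_cauchy_schwarz (ha : a.IsHermitian)
    (hpos : ∀ v : ι → ℂ, v ≠ 0 → 0 < (v ⬝ᵥ a *ᵥ star v).re) (v w : ι → ℂ) :
    Complex.normSq (v ⬝ᵥ a *ᵥ star w) ≤ (v ⬝ᵥ a *ᵥ star v).re * (w ⬝ᵥ a *ᵥ star w).re := by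
  let c : PreInnerProductSpace.Core ℂ (ι → ℂ) :=
    { inner := fun x y => y ⬝ᵥ a *ᵥ star x
      conj_inner_symm := fun x y => by
        rw [starRingEnd_apply, star_dotProduct_mulVec_star, ha.eq]
      re_inner_nonneg := fun x => by
        by_cases hx : x = 0
        · simp [hx]
        · exact (hpos x hx).le
      add_left := fun x y z => by rw [star_add, mulVec_add, dotProduct_add]
      smul_left := fun x y r => by
        rw [star_smul, mulVec_smul, dotProduct_smul, starRingEnd_apply, smul_eq_mul] }
  have h := @InnerProductSpace.Core.inner_mul_inner_self_le ℂ (ι → ℂ) _ _ _ c v w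
  rw [InnerProductSpace.Core.norm_inner_symm, ← sq, ← Complex.normSq_eq_norm_sq] at h
  exact h

/-- With `a = (g_{i j̄})`, `B = ∂_u g` and `D = ∂_u ∂̄_u g` at a point, and a section `v` with
derivative `v'`, the derivatives of the squared length `G` of the section satisfy
`G ∂∂̄G - ∂G ∂̄G ≥ 0` when the curvature `R(u, ū, v, v̄)` is non-positive. The reason is that
`∂∂̄G = |∇v|² - R` and `∂G = ⟨∇v, v⟩`, so that the Cauchy-Schwarz inequality applies. -/
lemma curvature_algebra [DecidableEq ι] (ha : a.IsHermitian)
    (hpos : ∀ v : ι → ℂ, v ≠ 0 → 0 < (v ⬝ᵥ a *ᵥ star v).re) (B D : Matrix ι ι ℂ) (v v' : ι → ℂ)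
    (hR : (-(v ⬝ᵥ D *ᵥ star v) + (v ᵥ* B) ⬝ᵥ a⁻¹ *ᵥ (Bᴴ *ᵥ star v)).re ≤ 0) :
    0 ≤ ((v ⬝ᵥ a *ᵥ star v) * (v ⬝ᵥ D *ᵥ star v + v' ⬝ᵥ Bᴴ *ᵥ star v + v ⬝ᵥ B *ᵥ star v'
        + v' ⬝ᵥ a *ᵥ star v')
      - (v ⬝ᵥ B *ᵥ star v + v' ⬝ᵥ a *ᵥ star v)
        * (v ⬝ᵥ Bᴴ *ᵥ star v + v ⬝ᵥ a *ᵥ star v')).re := by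
  have hdet : IsUnit a.det := by
    rw [isUnit_iff_ne_zero]
    intro h0
    obtain ⟨w, hw, hw0⟩ := Matrix.exists_mulVec_eq_zero_iff.2 h0
    have := hpos (star w) (by simpa using hw)
    simp [hw0] at this
  -- The covariant derivative of the section.
  set x : ι → ℂ := v' + (v ᵥ* B) ᵥ* a⁻¹ with hx
  have hxstar : a *ᵥ star x = a *ᵥ star v' + Bᴴ *ᵥ star v := by
    rw [hx, star_add, mulVec_add, star_vecMul, star_vecMul, ha.inv.eq, mulVec_mulVec,
      Matrix.mul_nonsing_inv _ hdet, one_mulVec]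
  have hxl : ∀ y, x ⬝ᵥ a *ᵥ y = v' ⬝ᵥ a *ᵥ y + v ⬝ᵥ B *ᵥ y := fun y => by
    rw [hx, add_dotProduct, dotProduct_mulVec (_ ᵥ* a⁻¹) a y, vecMul_vecMul,
      Matrix.nonsing_inv_mul _ hdet, vecMul_one, dotProduct_mulVec v B]
  have e1 : v ⬝ᵥ B *ᵥ star v + v' ⬝ᵥ a *ᵥ star v = x ⬝ᵥ a *ᵥ star v := by
    rw [hxl, add_comm]
  have e2 : v ⬝ᵥ Bᴴ *ᵥ star v + v ⬝ᵥ a *ᵥ star v' = star (x ⬝ᵥ a *ᵥ star v) := by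
    rw [star_dotProduct_mulVec_star, ha.eq, hxstar, dotProduct_add, add_comm]
  have e3 : v ⬝ᵥ D *ᵥ star v + v' ⬝ᵥ Bᴴ *ᵥ star v + v ⬝ᵥ B *ᵥ star v' + v' ⬝ᵥ a *ᵥ star v'
      = x ⬝ᵥ a *ᵥ star x - (-(v ⬝ᵥ D *ᵥ star v) + (v ᵥ* B) ⬝ᵥ a⁻¹ *ᵥ (Bᴴ *ᵥ star v)) := by
    have h1 : x ⬝ᵥ Bᴴ *ᵥ star v
        = v' ⬝ᵥ Bᴴ *ᵥ star v + (v ᵥ* B) ⬝ᵥ a⁻¹ *ᵥ (Bᴴ *ᵥ star v) := by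
      rw [hx, add_dotProduct, dotProduct_mulVec (v ᵥ* B) a⁻¹]
    rw [hxstar, dotProduct_add, hxl, h1]
    ring
  rw [e1, e2, e3]
  have hcs := hermitian_cauchy_schwarz ha hpos x v
  have hv : 0 ≤ (v ⬝ᵥ a *ᵥ star v).re := by
    by_cases h0 : v = 0
    · simp [h0]
    · exact (hpos v h0).le
  rw [Complex.star_def, Complex.mul_conj, Complex.sub_re, Complex.mul_re,
    dotProduct_mulVec_star_im ha v, Complex.ofReal_re, Complex.sub_re]
  nlinarith [mul_nonneg hv (neg_nonneg.2 hR)]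

end Algebra

section Pullback

variable {n : ℕ}

/-- The squared length `∑ g_{i j̄}(y) V^i V̄^j` of the section `V` along the curve `y`. -/
def curveNormSq (A : EuclideanSpace ℂ (Fin n) → Matrix (Fin n) (Fin n) ℂ)
    (y V : ℂ → EuclideanSpace ℂ (Fin n)) (t : ℂ) : ℂ :=
  ∑ i, ∑ j, A (y t) i j * V t i * conj (V t j)

lemma sum_sum_eq_dotProduct {ι : Type*} [Fintype ι] (B : Matrix ι ι ℂ) (v w : ι → ℂ) :
    ∑ i, ∑ j, B i j * v i * conj (w j) = v ⬝ᵥ B *ᵥ star w := by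
  simp only [dotProduct, mulVec, Finset.mul_sum, Pi.star_apply, starRingEnd_apply]
  exact Finset.sum_congr rfl fun i _ => Finset.sum_congr rfl fun j _ => by ring

/-- The contraction `R(u, ū, v, v̄)` in matrix form, in terms of the directional derivatives of
the metric. -/
lemma contracted_curvature_eq {ι : Type*} [Fintype ι] (S : ι → ι → ι → ι → ℂ)
    (T Tbar : ι → ι → ι → ℂ) (a' : Matrix ι ι ℂ) (u v : ι → ℂ) :
    ∑ k, ∑ l, ∑ i, ∑ j, (-S k l i j + ∑ p, ∑ q, a' q p * T k i q * Tbar l p j)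
        * u k * conj (u l) * v i * conj (v j)
      = -(v ⬝ᵥ (Matrix.of fun i j => ∑ k, ∑ l, S k l i j * u k * conj (u l)) *ᵥ star v)
        + (v ᵥ* Matrix.of fun i j => ∑ k, u k * T k i j) ⬝ᵥ a' *ᵥ
          ((Matrix.of fun i j => ∑ k, conj (u k) * Tbar k i j) *ᵥ star v) := by
  have hsec : (v ᵥ* Matrix.of fun i j => ∑ k, u k * T k i j) ⬝ᵥ a' *ᵥ
        ((Matrix.of fun i j => ∑ k, conj (u k) * Tbar k i j) *ᵥ star v)
      = v ⬝ᵥ ((Matrix.of fun i j => ∑ k, u k * T k i j) * a' *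
        (Matrix.of fun i j => ∑ k, conj (u k) * Tbar k i j)) *ᵥ star v := by
    rw [mulVec_mulVec, ← dotProduct_mulVec, mulVec_mulVec, Matrix.mul_assoc]
  have hswap : ∀ F : ι → ι → ι → ι → ℂ,
      ∑ k, ∑ l, ∑ i, ∑ j, F k l i j = ∑ i, ∑ j, ∑ k, ∑ l, F k l i j := fun F => by
    calc ∑ k, ∑ l, ∑ i, ∑ j, F k l i j = ∑ k, ∑ i, ∑ l, ∑ j, F k l i j :=
          Finset.sum_congr rfl fun k _ => Finset.sum_comm
      _ = ∑ i, ∑ k, ∑ l, ∑ j, F k l i j := Finset.sum_comm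
      _ = ∑ i, ∑ k, ∑ j, ∑ l, F k l i j := Finset.sum_congr rfl fun i _ =>
          Finset.sum_congr rfl fun k _ => Finset.sum_comm
      _ = ∑ i, ∑ j, ∑ k, ∑ l, F k l i j := Finset.sum_congr rfl fun i _ => Finset.sum_comm
  rw [hsec, hswap, ← dotProduct_neg, ← neg_mulVec, ← dotProduct_add, ← add_mulVec,
    ← sum_sum_eq_dotProduct]
  refine Finset.sum_congr rfl fun i _ => Finset.sum_congr rfl fun j _ => ?_
  have hentry : ((Matrix.of fun i j => ∑ k, u k * T k i j) * a' *
        (Matrix.of fun i j => ∑ k, conj (u k) * Tbar k i j)) i j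
      = ∑ k, ∑ l, (∑ p, ∑ q, a' q p * T k i q * Tbar l p j) * u k * conj (u l) := by
    simp only [Matrix.mul_apply, Matrix.of_apply, Finset.sum_mul, Finset.mul_sum]
    rw [← hswap fun p q k l => a' q p * T k i q * Tbar l p j * u k * conj (u l)]
    refine Finset.sum_congr rfl fun p _ => ?_
    rw [Finset.sum_comm]
    refine Finset.sum_congr rfl fun q _ => ?_
    rw [Finset.sum_comm]
    exact Finset.sum_congr rfl fun k _ => Finset.sum_congr rfl fun l _ => by ring
  rw [Matrix.add_apply, Matrix.neg_apply, hentry, Matrix.of_apply, ← Finset.sum_neg_distrib,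
    ← Finset.sum_add_distrib, Finset.sum_mul, Finset.sum_mul]
  refine Finset.sum_congr rfl fun k _ => ?_
  rw [← Finset.sum_neg_distrib, ← Finset.sum_add_distrib, Finset.sum_mul, Finset.sum_mul]
  exact Finset.sum_congr rfl fun l _ => by ring

/-- The logarithm of the squared length `G` of a holomorphic section along a holomorphic curve is
subharmonic at `t` in non-positive bisectional curvature, in the form `G ∂∂̄G - ∂G ∂̄G ≥ 0`, which
also makes sense at a zero of the section. Here `a = ∂G`, `b = ∂̄G` and `c = ∂∂̄G`; the section need
not be related to the velocity of the curve. -/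
lemma exists_wirtinger_curveNormSq {A : EuclideanSpace ℂ (Fin n) → Matrix (Fin n) (Fin n) ℂ}
    {y y' V V' : ℂ → EuclideanSpace ℂ (Fin n)} {y'' V'' : EuclideanSpace ℂ (Fin n)} {t : ℂ}
    (hA : ∀ i j, ContDiffAt ℝ 2 (fun z => A z i j) (y t))
    (hherm : ∀ᶠ z in 𝓝 (y t), (A z).IsHermitian)
    (hpos : ∀ v : Fin n → ℂ, v ≠ 0 → 0 < (v ⬝ᵥ A (y t) *ᵥ star v).re)
    (hR : ∀ u v : Fin n → ℂ, (∑ k, ∑ l, ∑ i, ∑ j,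
      (- wirtinger k (wirtingerBar l fun x => A x i j) (y t)
        + ∑ p, ∑ q, (A (y t))⁻¹ q p * wirtinger k (fun x => A x i q) (y t)
          * wirtingerBar l (fun x => A x p j) (y t))
      * u k * starRingEnd ℂ (u l) * v i * starRingEnd ℂ (v j)).re ≤ 0)
    (hy : ∀ᶠ s in 𝓝 t, HasDerivAt y (y' s) s) (hy' : HasDerivAt y' y'' t)
    (hV : ∀ᶠ s in 𝓝 t, HasDerivAt V (V' s) s) (hV' : HasDerivAt V' V'' t) :
    ∃ (a b : ℂ → ℂ) (c d : ℂ),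
      (∀ᶠ s in 𝓝 t, HasWirtingerAt (curveNormSq A y V) (a s) (b s) s) ∧
      HasWirtingerAt b c d t ∧ 0 ≤ (curveNormSq A y V t * c - a t * b t).re := by
  have hcomp : ∀ {Y : ℂ → EuclideanSpace ℂ (Fin n)} {Y' : EuclideanSpace ℂ (Fin n)} {s : ℂ},
      HasDerivAt Y Y' s → ∀ i, HasWirtingerAt (fun s => Y s i) (Y' i) 0 s := fun h i =>
    hasWirtingerAt_of_hasDerivAt
      ((EuclideanSpace.proj (𝕜 := ℂ) i).hasFDerivAt.comp_hasDerivAt _ h)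
  -- `B = ∂A/∂t` and `C = ∂A/∂t̄` along the curve, and `D = ∂²A/∂t∂t̄` at `t`.
  set B : ℂ → Matrix (Fin n) (Fin n) ℂ := fun s =>
    Matrix.of fun i j => ∑ k, y' s k * wirtinger k (fun z => A z i j) (y s) with hB
  set C : ℂ → Matrix (Fin n) (Fin n) ℂ := fun s =>
    Matrix.of fun i j => ∑ k, conj (y' s k) * wirtingerBar k (fun z => A z i j) (y s) with hC
  set D : Matrix (Fin n) (Fin n) ℂ := Matrix.of fun i j => ∑ k, ∑ l,
    wirtinger k (wirtingerBar l fun z => A z i j) (y t) * y' t k * conj (y' t l) with hD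
  have hA1 : ∀ᶠ s in 𝓝 t, ∀ i j, HasWirtingerAt (fun s => A (y s) i j) (B s i j) (C s i j) s := by
    simp only [eventually_all]
    exact fun i j => eventually_hasWirtingerAt_comp_curve (hA i j) hy
  have hA2 : ∀ i j, ∃ d, HasWirtingerAt (fun s => C s i j) (D i j) d t := fun i j =>
    hasWirtingerAt_wirtingerBar_comp_curve (hA i j) hy.self_of_nhds hy'
  choose D' hD' using hA2
  have hCB : C t = (B t)ᴴ := by
    ext i j
    have h1 := (hA1.self_of_nhds j i).star
    have h2 : HasWirtingerAt (fun s => A (y s) i j) _ _ t := h1.congr_of_eventuallyEq (by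
      filter_upwards [hy.self_of_nhds.continuousAt.eventually hherm] with s hs
      exact (hs.apply i j).symm)
    exact ((hA1.self_of_nhds i j).unique h2).2
  refine ⟨fun s => ∑ i, ∑ j, (B s i j * V s i * conj (V s j) + A (y s) i j * V' s i * conj (V s j)),
    fun s => ∑ i, ∑ j, (C s i j * V s i * conj (V s j) + A (y s) i j * V s i * conj (V' s j)),
    ∑ i, ∑ j, (D i j * V t i * conj (V t j) + C t i j * V' t i * conj (V t j)
      + B t i j * V t i * conj (V' t j) + A (y t) i j * V' t i * conj (V' t j)), _, ?_,
    (HasWirtingerAt.sum fun i _ => HasWirtingerAt.sum fun j _ =>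
      (((hD' i j).mul (hcomp hV.self_of_nhds i)).mul (hcomp hV.self_of_nhds j).star).add
      (((hA1.self_of_nhds i j).mul (hcomp hV.self_of_nhds i)).mul
        (hcomp hV' j).star)).congr_wirtinger ?_ rfl, ?_⟩
  · filter_upwards [hA1, hV] with s hs hVs
    refine (HasWirtingerAt.sum fun i _ => HasWirtingerAt.sum fun j _ =>
      ((hs i j).mul (hcomp hVs i)).mul (hcomp hVs j).star).congr_wirtinger ?_ ?_
    all_goals
      refine Finset.sum_congr rfl fun i _ => Finset.sum_congr rfl fun j _ => ?_
      simp
    ring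
  · refine Finset.sum_congr rfl fun i _ => Finset.sum_congr rfl fun j _ => ?_
    simp
    ring
  · have hRt : (-(V t ⬝ᵥ D *ᵥ star (V t))
        + (V t ᵥ* B t) ⬝ᵥ (A (y t))⁻¹ *ᵥ ((B t)ᴴ *ᵥ star (V t))).re ≤ 0 := by
      convert hR (y' t) (V t) using 2
      rw [← hCB]
      exact (contracted_curvature_eq _ _ _ _ _ _).symm
    have := curvature_algebra hherm.self_of_nhds hpos (B t) D (V t) (V' t) hRt
    simp only [curveNormSq, Finset.sum_add_distrib, sum_sum_eq_dotProduct, hCB]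
    exact this

end Pullback

/-! ### Metrics and derivatives in charts -/

section InnerCore

variable {V : Type*} [AddCommGroup V] [Module ℂ V] (c : InnerProductSpace.Core ℂ V)

lemma core_inner_smul_self (r : ℂ) (v : V) :
    c.inner (r • v) (r • v) = Complex.normSq r * c.inner v v := by
  let := c.toNormedAddCommGroup
  let : InnerProductSpace ℂ V := InnerProductSpace.ofCore c.toCore
  have h : inner ℂ (r • v) (r • v) = Complex.normSq r * inner ℂ v v := by
    rw [inner_smul_left, inner_smul_right, ← mul_assoc, Complex.normSq_eq_conj_mul_self]
  exact h

lemma core_inner_sum_self {ι : Type*} [Fintype ι] (a : ι → ℂ) (X : ι → V) :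
    c.inner (∑ i, a i • X i) (∑ i, a i • X i)
      = ∑ i, ∑ j, c.inner (X j) (X i) * a i * conj (a j) := by
  let := c.toNormedAddCommGroup
  let : InnerProductSpace ℂ V := InnerProductSpace.ofCore c.toCore
  have h : inner ℂ (∑ i, a i • X i) (∑ i, a i • X i)
      = ∑ i, ∑ j, inner ℂ (X j) (X i) * a i * conj (a j) := by
    simp only [inner_sum, sum_inner, inner_smul_left, inner_smul_right, Finset.mul_sum]
    exact Finset.sum_congr rfl fun i _ => Finset.sum_congr rfl fun j _ => by ring
  exact h

end InnerCore

section Metric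

variable {n : ℕ} {N : Type*} [TopologicalSpace N] [ChartedSpace (EuclideanSpace ℂ (Fin n)) N]

/-- The squared length of `v` at `q`, with `v` seen as a vector of `ℂ^n`, the model of all the
tangent spaces; this lets the base point vary freely. -/
def HermitianMetric.innerSelf (g : HermitianMetric n N) (q : N) (v : EuclideanSpace ℂ (Fin n)) :
    ℂ :=
  (g.core q).inner v v

lemma HermitianMetric.innerSelf_im (g : HermitianMetric n N) (q : N)
    (v : EuclideanSpace ℂ (Fin n)) : (g.innerSelf q v).im = 0 :=
  Complex.conj_eq_iff_im.1 ((g.core q).conj_inner_symm v v)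

lemma HermitianMetric.innerSelf_re_nonneg (g : HermitianMetric n N) (q : N)
    (v : EuclideanSpace ℂ (Fin n)) : 0 ≤ (g.innerSelf q v).re :=
  (g.core q).re_inner_nonneg v

lemma HermitianMetric.innerSelf_re_pos (g : HermitianMetric n N) (q : N)
    {v : EuclideanSpace ℂ (Fin n)} (hv : v ≠ 0) : 0 < (g.innerSelf q v).re := by
  refine (g.innerSelf_re_nonneg q v).lt_of_ne' fun h => hv ?_
  exact (g.core q).definite v (Complex.ext h (g.innerSelf_im q v))

lemma HermitianMetric.innerSelf_smul (g : HermitianMetric n N) (q : N) (c : ℂ)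
    (v : EuclideanSpace ℂ (Fin n)) :
    g.innerSelf q (c • v) = Complex.normSq c * g.innerSelf q v :=
  core_inner_smul_self (g.core q) c v

lemma coordVector_smul (φ : OpenPartialHomeomorph N (EuclideanSpace ℂ (Fin n)))
    (z v : EuclideanSpace ℂ (Fin n)) (c : ℂ) :
    coordVector φ z (c • v) = c • coordVector φ z v :=
  map_smul (mfderiv 𝓘(ℂ, EuclideanSpace ℂ (Fin n)) 𝓘(ℂ, EuclideanSpace ℂ (Fin n)) φ.symm z) c v

lemma innerSelf_coordVector (g : HermitianMetric n N)
    (φ : OpenPartialHomeomorph N (EuclideanSpace ℂ (Fin n))) (z v : EuclideanSpace ℂ (Fin n)) :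
    g.innerSelf (φ.symm z) (coordVector φ z v)
      = ∑ i, ∑ j, metricMatrix g.core φ z i j * v i * conj (v j) := by
  have hv : v = ∑ i, v i • EuclideanSpace.single i (1 : ℂ) := by
    ext i
    simp [Finset.sum_apply, Pi.single_apply]
  have hX : coordVector φ z v = ∑ i, v i • coordVector φ z (EuclideanSpace.single i 1) := by
    conv_lhs => rw [hv]
    exact (map_sum (mfderiv 𝓘(ℂ, EuclideanSpace ℂ (Fin n)) 𝓘(ℂ, EuclideanSpace ℂ (Fin n)) φ.symm z)
      _ _).trans (Finset.sum_congr rfl fun i _ => coordVector_smul φ z _ _)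
  exact (congrArg (fun w => (g.core (φ.symm z)).inner w w) hX).trans
    (core_inner_sum_self (g.core (φ.symm z)) (fun i => v i) _)

lemma metricMatrix_isHermitian (g : HermitianMetric n N)
    (φ : OpenPartialHomeomorph N (EuclideanSpace ℂ (Fin n))) (z : EuclideanSpace ℂ (Fin n)) :
    (metricMatrix g.core φ z).IsHermitian := by
  ext i j
  exact (g.core (φ.symm z)).conj_inner_symm _ _

variable [IsManifold 𝓘(ℂ, EuclideanSpace ℂ (Fin n)) ω N]

lemma bijective_coordVector {φ : OpenPartialHomeomorph N (EuclideanSpace ℂ (Fin n))}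
    (hφ : φ ∈ atlas (EuclideanSpace ℂ (Fin n)) N) {z : EuclideanSpace ℂ (Fin n)}
    (hz : z ∈ φ.target) : Function.Bijective (coordVector φ z) := by
  have : IsManifold 𝓘(ℂ, EuclideanSpace ℂ (Fin n)) 1 N := IsManifold.of_le (n := ω) le_top
  exact (mdifferentiable_of_mem_atlas
    (I := 𝓘(ℂ, EuclideanSpace ℂ (Fin n))) hφ).symm.mfderiv_bijective hz

lemma coordVector_eq_zero_iff {φ : OpenPartialHomeomorph N (EuclideanSpace ℂ (Fin n))}
    (hφ : φ ∈ atlas (EuclideanSpace ℂ (Fin n)) N) {z v : EuclideanSpace ℂ (Fin n)}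
    (hz : z ∈ φ.target) : coordVector φ z v = 0 ↔ v = 0 := by
  have h0 : coordVector φ z 0 = 0 := map_zero
    (mfderiv 𝓘(ℂ, EuclideanSpace ℂ (Fin n)) 𝓘(ℂ, EuclideanSpace ℂ (Fin n)) φ.symm z)
  rw [← h0]
  exact (bijective_coordVector hφ hz).1.eq_iff

lemma metricMatrix_pos (g : HermitianMetric n N)
    {φ : OpenPartialHomeomorph N (EuclideanSpace ℂ (Fin n))}
    (hφ : φ ∈ atlas (EuclideanSpace ℂ (Fin n)) N) {z : EuclideanSpace ℂ (Fin n)}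
    (hz : z ∈ φ.target) (v : Fin n → ℂ) (hv : v ≠ 0) :
    0 < (v ⬝ᵥ metricMatrix g.core φ z *ᵥ star v).re := by
  have h := innerSelf_coordVector g φ z (WithLp.toLp 2 v)
  rw [sum_sum_eq_dotProduct] at h
  rw [← h]
  refine g.innerSelf_re_pos _ ?_
  refine (coordVector_eq_zero_iff hφ hz).not.2 ?_
  simpa using hv

end Metric

section Map

lemma eventually_mem_source {X Y Z W : Type*} [TopologicalSpace X] [TopologicalSpace Y]
    [TopologicalSpace Z] [TopologicalSpace W] {f : X → Y} {φ : OpenPartialHomeomorph X Z}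
    {ψ : OpenPartialHomeomorph Y W} (hf : Continuous f) {z : Z} (hz : z ∈ φ.target)
    (hfz : f (φ.symm z) ∈ ψ.source) :
    ∀ᶠ x in 𝓝 z, x ∈ φ.target ∧ f (φ.symm x) ∈ ψ.source :=
  (φ.open_target.eventually_mem hz).and
    ((hf.continuousAt.comp (φ.continuousAt_symm hz)).eventually (ψ.open_source.mem_nhds hfz))


variable {m n : ℕ}
    {M : Type*} [TopologicalSpace M] [ChartedSpace (EuclideanSpace ℂ (Fin m)) M]
    {N : Type*} [TopologicalSpace N] [ChartedSpace (EuclideanSpace ℂ (Fin n)) N]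

/-- The expression of `f` in the charts `φ` of the source and `ψ` of the target; it is meaningful
only at points `z ∈ φ.target` with `f (φ.symm z) ∈ ψ.source`. -/
def inCharts (φ : OpenPartialHomeomorph M (EuclideanSpace ℂ (Fin m)))
    (ψ : OpenPartialHomeomorph N (EuclideanSpace ℂ (Fin n))) (f : M → N) :
    EuclideanSpace ℂ (Fin m) → EuclideanSpace ℂ (Fin n) :=
  fun z => ψ (f (φ.symm z))

/-- The differential of `f` at `p`, as a linear map between the models of the tangent spaces. -/
def differential (f : M → N) (p : M) : EuclideanSpace ℂ (Fin m) →L[ℂ] EuclideanSpace ℂ (Fin n) :=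
  mfderiv 𝓘(ℂ, EuclideanSpace ℂ (Fin m)) 𝓘(ℂ, EuclideanSpace ℂ (Fin n)) f p

/-- The squared length `|df(W)|²_g` of the image of a tangent vector `W` at `p`. -/
def energy (g : HermitianMetric n N) (f : M → N) (p : M) (W : EuclideanSpace ℂ (Fin m)) : ℝ :=
  (g.innerSelf (f p) (differential f p W)).re

lemma energy_smul (g : HermitianMetric n N) (f : M → N) (p : M) (c : ℂ)
    (W : EuclideanSpace ℂ (Fin m)) :
    energy g f p (c • W) = Complex.normSq c * energy g f p W := by
  rw [energy, map_smul, g.innerSelf_smul, Complex.re_ofReal_mul, energy]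

variable [IsManifold 𝓘(ℂ, EuclideanSpace ℂ (Fin m)) ω M]
  [IsManifold 𝓘(ℂ, EuclideanSpace ℂ (Fin n)) ω N] {f : M → N}
  {φ : OpenPartialHomeomorph M (EuclideanSpace ℂ (Fin m))}
  {ψ : OpenPartialHomeomorph N (EuclideanSpace ℂ (Fin n))}

lemma contDiffAt_inCharts
    (hf : ContMDiff 𝓘(ℂ, EuclideanSpace ℂ (Fin m)) 𝓘(ℂ, EuclideanSpace ℂ (Fin n)) ω f)
    (hφ : φ ∈ atlas (EuclideanSpace ℂ (Fin m)) M) (hψ : ψ ∈ atlas (EuclideanSpace ℂ (Fin n)) N)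
    {z : EuclideanSpace ℂ (Fin m)} (hz : z ∈ φ.target) (hfz : f (φ.symm z) ∈ ψ.source) :
    ContDiffAt ℂ ω (inCharts φ ψ f) z := by
  have h1 := (contMDiffOn_symm_of_mem_maximalAtlas
    (IsManifold.subset_maximalAtlas (I := 𝓘(ℂ, EuclideanSpace ℂ (Fin m))) (n := ω) hφ)).contMDiffAt
    (φ.open_target.mem_nhds hz)
  have h2 := (contMDiffOn_of_mem_maximalAtlas
    (IsManifold.subset_maximalAtlas (I := 𝓘(ℂ, EuclideanSpace ℂ (Fin n))) (n := ω) hψ)).contMDiffAt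
    (ψ.open_source.mem_nhds hfz)
  exact (ContMDiffAt.comp z h2 (ContMDiffAt.comp z hf.contMDiffAt h1)).contDiffAt

/-- The chain rule in charts: in coordinates, `df` is the derivative of the expression of `f`. -/
lemma differential_coordVector
    (hf : ContMDiff 𝓘(ℂ, EuclideanSpace ℂ (Fin m)) 𝓘(ℂ, EuclideanSpace ℂ (Fin n)) ω f)
    (hφ : φ ∈ atlas (EuclideanSpace ℂ (Fin m)) M) (hψ : ψ ∈ atlas (EuclideanSpace ℂ (Fin n)) N)
    {z : EuclideanSpace ℂ (Fin m)} (hz : z ∈ φ.target) (hfz : f (φ.symm z) ∈ ψ.source)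
    (w : EuclideanSpace ℂ (Fin m)) :
    differential f (φ.symm z) (coordVector φ z w)
      = coordVector ψ (inCharts φ ψ f z) (fderiv ℂ (inCharts φ ψ f) z w) := by
  have : IsManifold 𝓘(ℂ, EuclideanSpace ℂ (Fin m)) 1 M := IsManifold.of_le (n := ω) le_top
  have : IsManifold 𝓘(ℂ, EuclideanSpace ℂ (Fin n)) 1 N := IsManifold.of_le (n := ω) le_top
  have heq : f ∘ φ.symm =ᶠ[𝓝 z] ψ.symm ∘ inCharts φ ψ f := by
    filter_upwards [eventually_mem_source hf.continuous hz hfz] with x hx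
    exact (ψ.left_inv hx.2).symm
  have h1 := mfderiv_comp z (hf.mdifferentiable (by simp) (φ.symm z))
    (mdifferentiableAt_atlas_symm (I := 𝓘(ℂ, EuclideanSpace ℂ (Fin m))) hφ hz)
  have h2 := mfderiv_comp z
    (mdifferentiableAt_atlas_symm (I := 𝓘(ℂ, EuclideanSpace ℂ (Fin n))) hψ
      (ψ.map_source hfz : inCharts φ ψ f z ∈ ψ.target))
    ((contDiffAt_inCharts hf hφ hψ hz hfz).differentiableAt (by simp)).mdifferentiableAt
  rw [← heq.mfderiv_eq, mfderiv_eq_fderiv] at h2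
  have h3 := h1.symm.trans h2
  exact congrArg (fun L : EuclideanSpace ℂ (Fin m) →L[ℂ] EuclideanSpace ℂ (Fin n) => L w) h3

lemma energy_coordVector (g : HermitianMetric n N)
    (hf : ContMDiff 𝓘(ℂ, EuclideanSpace ℂ (Fin m)) 𝓘(ℂ, EuclideanSpace ℂ (Fin n)) ω f)
    (hφ : φ ∈ atlas (EuclideanSpace ℂ (Fin m)) M) (hψ : ψ ∈ atlas (EuclideanSpace ℂ (Fin n)) N)
    {z : EuclideanSpace ℂ (Fin m)} (hz : z ∈ φ.target) (hfz : f (φ.symm z) ∈ ψ.source)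
    (w : EuclideanSpace ℂ (Fin m)) :
    (energy g f (φ.symm z) (coordVector φ z w) : ℂ)
      = ∑ i, ∑ j, metricMatrix g.core ψ (inCharts φ ψ f z) i j
        * fderiv ℂ (inCharts φ ψ f) z w i * conj (fderiv ℂ (inCharts φ ψ f) z w j) := by
  rw [← innerSelf_coordVector, ← differential_coordVector hf hφ hψ hz hfz]
  have hq : ψ.symm (inCharts φ ψ f z) = f (φ.symm z) := ψ.left_inv hfz
  rw [hq]
  exact Complex.ext rfl (g.innerSelf_im _ _).symm

lemma isConst_of_differential_eq_zero [ConnectedSpace M]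
    (hf : ContMDiff 𝓘(ℂ, EuclideanSpace ℂ (Fin m)) 𝓘(ℂ, EuclideanSpace ℂ (Fin n)) ω f)
    (h0 : ∀ p, differential (m := m) (n := n) f p = 0) :
    ∃ c, ∀ p, f p = c := by
  obtain ⟨p₀⟩ := (inferInstance : Nonempty M)
  have : Nonempty N := ⟨f p₀⟩
  suffices IsLocallyConstant f by
    obtain ⟨c, hc⟩ := this.exists_eq_const
    exact ⟨c, fun p => by rw [hc, Function.const_apply]⟩
  rw [IsLocallyConstant.iff_eventually_eq]
  intro p
  let φ := chartAt (EuclideanSpace ℂ (Fin m)) p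
  let ψ := chartAt (EuclideanSpace ℂ (Fin n)) (f p)
  have hφ : φ ∈ atlas (EuclideanSpace ℂ (Fin m)) M := chart_mem_atlas _ p
  have hψ : ψ ∈ atlas (EuclideanSpace ℂ (Fin n)) N := chart_mem_atlas _ (f p)
  have hp : p ∈ φ.source := mem_chart_source _ p
  have hpz : φ.symm (φ p) = p := φ.left_inv hp
  have hfp : f (φ.symm (φ p)) ∈ ψ.source := by
    rw [hpz]
    exact mem_chart_source _ (f p)
  obtain ⟨r, hr, hball⟩ := Metric.eventually_nhds_iff_ball.1
    (eventually_mem_source hf.continuous (φ.map_source hp) hfp)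
  have hzero : ∀ z ∈ Metric.ball (φ p) r, fderiv ℂ (inCharts φ ψ f) z = 0 := fun z hz => by
    refine ContinuousLinearMap.ext fun w => ?_
    have h1 := differential_coordVector hf hφ hψ (hball z hz).1 (hball z hz).2 w
    rw [h0] at h1
    exact (coordVector_eq_zero_iff hψ (ψ.map_source (hball z hz).2)).1 h1.symm
  filter_upwards [φ.open_source.mem_nhds hp,
    (φ.continuousAt hp).preimage_mem_nhds (Metric.ball_mem_nhds _ hr)] with q hq hqr
  have hconst := Metric.isOpen_ball.is_const_of_fderiv_eq_zero
    (convex_ball (φ p) r).isPreconnected (fun z hz => ((contDiffAt_inCharts hf hφ hψ (hball z hz).1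
      (hball z hz).2).differentiableAt (by simp)).differentiableWithinAt) hzero hqr
    (Metric.mem_ball_self hr)
  have hq2 := (hball _ hqr).2
  refine ψ.injOn ?_ (mem_chart_source _ (f p)) ?_
  · rwa [φ.left_inv hq] at hq2
  · unfold inCharts at hconst
    rwa [φ.left_inv hq, hpz] at hconst

end Map

/-! ### The energy ratio on the projectivized tangent bundle attains its maximum -/

section Taut

variable {m : ℕ} {M : Type*} [TopologicalSpace M] [ChartedSpace (EuclideanSpace ℂ (Fin m)) M]
  (h : ∀ x : ProjTangentBundle m M, InnerProductSpace.Core ℂ (TautFibre x)) (p : M)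

lemma tautNormSq_eq {W : TangentSpace 𝓘(ℂ, EuclideanSpace ℂ (Fin m)) p} (hW : W ≠ 0)
    {l : Projectivization ℂ (TangentSpace 𝓘(ℂ, EuclideanSpace ℂ (Fin m)) p)}
    (hl : Projectivization.mk ℂ W hW = l) (hmem : W ∈ l.submodule) :
    tautNormSq h p W = ((h ⟨p, l⟩).inner ⟨W, hmem⟩ ⟨W, hmem⟩).re := by
  subst hl
  rw [tautNormSq, dif_pos hW]
  rfl

lemma tautNormSq_smul {c : ℂ} (hc : c ≠ 0) (W : TangentSpace 𝓘(ℂ, EuclideanSpace ℂ (Fin m)) p) :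
    tautNormSq h p (c • W) = Complex.normSq c * tautNormSq h p W := by
  by_cases hW : W = 0
  · simp [hW, tautNormSq]
  have hcW : c • W ≠ 0 := smul_ne_zero hc hW
  have hl : Projectivization.mk ℂ (c • W) hcW = Projectivization.mk ℂ W hW :=
    (Projectivization.mk_eq_mk_iff' ℂ _ _ _ _).2 ⟨c, rfl⟩
  have hmem : W ∈ (Projectivization.mk ℂ W hW).submodule := Submodule.mem_span_singleton_self W
  rw [tautNormSq_eq h p hcW hl (Submodule.smul_mem _ c hmem), tautNormSq_eq h p hW rfl hmem,
    ← Complex.re_ofReal_mul, ← core_inner_smul_self]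
  rfl

lemma tautNormSq_pos {W : TangentSpace 𝓘(ℂ, EuclideanSpace ℂ (Fin m)) p} (hW : W ≠ 0) :
    0 < tautNormSq h p W := by
  have hmem : W ∈ (Projectivization.mk ℂ W hW).submodule := Submodule.mem_span_singleton_self W
  rw [tautNormSq_eq h p hW rfl hmem]
  set c := h ⟨p, Projectivization.mk ℂ W hW⟩
  refine (c.re_inner_nonneg ⟨W, hmem⟩).lt_of_ne' fun h0 => hW ?_
  have := c.definite ⟨W, hmem⟩
    (Complex.ext h0 (Complex.conj_eq_iff_im.1 (c.conj_inner_symm ⟨W, hmem⟩ ⟨W, hmem⟩)))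
  exact congrArg Subtype.val this

end Taut

section Coordinates

variable {m : ℕ} {j : Fin m}

/-- The coordinates `ζ = (z, w)` from their two components. -/
def projCoord (j : Fin m) (x : EuclideanSpace ℂ (Fin m) × ({k : Fin m // k ≠ j} → ℂ)) :
    EuclideanSpace ℂ (ProjIndex j) :=
  WithLp.toLp 2 (Sum.elim x.1 x.2)

lemma continuous_projCoord : Continuous (projCoord j) := by
  refine (PiLp.continuous_toLp 2 _).comp (continuous_pi fun a => ?_)
  rcases a with α | k
  · exact (EuclideanSpace.proj (𝕜 := ℂ) α).continuous.comp continuous_fst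
  · exact (continuous_apply k).comp continuous_snd

@[simp]
lemma baseCoord_projCoord (x : EuclideanSpace ℂ (Fin m) × ({k : Fin m // k ≠ j} → ℂ)) :
    baseCoord (projCoord j x) = x.1 := rfl

lemma affineCoord_projCoord {w : EuclideanSpace ℂ (Fin m)} (hw : w j = 1)
    (z : EuclideanSpace ℂ (Fin m)) :
    affineCoord (projCoord j (z, fun k => w k)) = w := by
  ext k
  by_cases hk : k = j
  · subst hk
    simp [affineCoord, hw]
  · simp [affineCoord, projCoord, hk]

lemma affineCoord_ne_zero (ζ : EuclideanSpace ℂ (ProjIndex j)) : affineCoord ζ ≠ 0 := by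
  intro h0
  have := congrArg (fun w : EuclideanSpace ℂ (Fin m) => w j) h0
  simp [affineCoord] at this

lemma contDiff_baseCoord : ContDiff ℂ ω (baseCoord (j := j)) := by
  unfold baseCoord
  fun_prop

lemma contDiff_affineCoord : ContDiff ℂ ω (affineCoord (j := j)) := by
  unfold affineCoord
  rw [contDiff_piLp]
  intro k
  by_cases hk : k = j
  · simp only [hk, dite_true]
    fun_prop
  · simp only [hk, dite_false]
    fun_prop

end Coordinates

section Ratio

variable {m n : ℕ}
  {M : Type*} [TopologicalSpace M] [ChartedSpace (EuclideanSpace ℂ (Fin m)) M]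
  {N : Type*} [TopologicalSpace N] [ChartedSpace (EuclideanSpace ℂ (Fin n)) N]

/-- The ratio `|df(W)|²_g / h(W, W)`, which depends only on the line spanned by `W ≠ 0`. -/
def energyRatio (g : HermitianMetric n N) (h : TautHermitianMetric m M) (f : M → N) (p : M)
    (W : EuclideanSpace ℂ (Fin m)) : ℝ :=
  energy g f p W / tautNormSq h.core p W

lemma energyRatio_smul (g : HermitianMetric n N) (h : TautHermitianMetric m M) (f : M → N) (p : M)
    {c : ℂ} (hc : c ≠ 0) (W : EuclideanSpace ℂ (Fin m)) :
    energyRatio g h f p (c • W) = energyRatio g h f p W := by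
  have h1 : tautNormSq h.core p (c • W : EuclideanSpace ℂ (Fin m))
      = Complex.normSq c * tautNormSq h.core p W := tautNormSq_smul h.core p hc W
  unfold energyRatio
  rw [h1, energy_smul, mul_div_mul_left _ _ (by simpa using hc)]

variable [IsManifold 𝓘(ℂ, EuclideanSpace ℂ (Fin m)) ω M]
  [IsManifold 𝓘(ℂ, EuclideanSpace ℂ (Fin n)) ω N] {f : M → N}
  {φ : OpenPartialHomeomorph M (EuclideanSpace ℂ (Fin m))}
  {ψ : OpenPartialHomeomorph N (EuclideanSpace ℂ (Fin n))}

lemma tautWeight_pos (h : TautHermitianMetric m M) (hφ : φ ∈ atlas (EuclideanSpace ℂ (Fin m)) M)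
    {j : Fin m} {ζ : EuclideanSpace ℂ (ProjIndex j)} (hζ : baseCoord ζ ∈ φ.target) :
    0 < tautWeight h.core φ j ζ :=
  tautNormSq_pos _ _ ((coordVector_eq_zero_iff hφ hζ).not.2 (affineCoord_ne_zero ζ))

/-- The energy ratio in the holomorphic coordinates `ζ` of `P(T_M)`. -/
def localRatio (g : HermitianMetric n N) (h : TautHermitianMetric m M) (f : M → N)
    (φ : OpenPartialHomeomorph M (EuclideanSpace ℂ (Fin m))) (j : Fin m)
    (ζ : EuclideanSpace ℂ (ProjIndex j)) : ℝ :=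
  energyRatio g h f (φ.symm (baseCoord ζ)) (coordVector φ (baseCoord ζ) (affineCoord ζ))

lemma localRatio_mul_tautWeight (g : HermitianMetric n N) (h : TautHermitianMetric m M)
    (hf : ContMDiff 𝓘(ℂ, EuclideanSpace ℂ (Fin m)) 𝓘(ℂ, EuclideanSpace ℂ (Fin n)) ω f)
    (hφ : φ ∈ atlas (EuclideanSpace ℂ (Fin m)) M) (hψ : ψ ∈ atlas (EuclideanSpace ℂ (Fin n)) N)
    {j : Fin m} {ζ : EuclideanSpace ℂ (ProjIndex j)} (hζ : baseCoord ζ ∈ φ.target)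
    (hfζ : f (φ.symm (baseCoord ζ)) ∈ ψ.source) :
    (localRatio g h f φ j ζ : ℂ) * tautWeight h.core φ j ζ
      = ∑ i, ∑ k, metricMatrix g.core ψ (inCharts φ ψ f (baseCoord ζ)) i k
        * fderiv ℂ (inCharts φ ψ f) (baseCoord ζ) (affineCoord ζ) i
        * conj (fderiv ℂ (inCharts φ ψ f) (baseCoord ζ) (affineCoord ζ) k) := by
  rw [← energy_coordVector g hf hφ hψ hζ hfζ, ← Complex.ofReal_mul]
  congr 1
  exact div_mul_cancel₀ _ (tautWeight_pos h hφ hζ).ne'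

lemma continuousAt_localRatio (g : HermitianMetric n N) (h : TautHermitianMetric m M)
    (hf : ContMDiff 𝓘(ℂ, EuclideanSpace ℂ (Fin m)) 𝓘(ℂ, EuclideanSpace ℂ (Fin n)) ω f)
    (hφ : φ ∈ atlas (EuclideanSpace ℂ (Fin m)) M) {j : Fin m}
    {ζ : EuclideanSpace ℂ (ProjIndex j)} (hζ : baseCoord ζ ∈ φ.target) :
    ContinuousAt (localRatio g h f φ j) ζ := by
  let ψ := chartAt (EuclideanSpace ℂ (Fin n)) (f (φ.symm (baseCoord ζ)))
  have hψ : ψ ∈ atlas (EuclideanSpace ℂ (Fin n)) N := chart_mem_atlas _ _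
  have hfζ : f (φ.symm (baseCoord ζ)) ∈ ψ.source := mem_chart_source _ _
  have hbase := (contDiff_baseCoord (j := j)).continuous.continuousAt (x := ζ)
  have hopen : IsOpen {ζ : EuclideanSpace ℂ (ProjIndex j) | baseCoord ζ ∈ φ.target} :=
    φ.open_target.preimage contDiff_baseCoord.continuous
  have hw : ContinuousAt (fun ζ => (tautWeight h.core φ j ζ : ℂ)) ζ :=
    Complex.continuous_ofReal.continuousAt.comp
      ((h.smooth φ hφ j).continuousOn.continuousAt (hopen.mem_nhds hζ))
  have hF := contDiffAt_inCharts hf hφ hψ hζ hfζ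
  have hFc : ContinuousAt (fun ζ => inCharts φ ψ f (baseCoord ζ)) ζ :=
    ContinuousAt.comp (f := baseCoord) hF.continuousAt hbase
  have hV : ContinuousAt
      (fun ζ => fderiv ℂ (inCharts φ ψ f) (baseCoord ζ) (affineCoord ζ)) ζ := by
    have h1 : ContinuousAt (fun ζ => fderiv ℂ (inCharts φ ψ f) (baseCoord ζ)) ζ :=
      ContinuousAt.comp (f := baseCoord)
        (hF.fderiv_right (m := ω) (by simp)).continuousAt hbase
    exact h1.clm_apply contDiff_affineCoord.continuous.continuousAt
  have hg : ∀ i k, ContinuousAt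
      (fun ζ => metricMatrix g.core ψ (inCharts φ ψ f (baseCoord ζ)) i k) ζ := fun i k =>
    ContinuousAt.comp (f := fun ζ => inCharts φ ψ f (baseCoord ζ))
      ((g.smooth ψ hψ i k).continuousOn.continuousAt
        (ψ.open_target.mem_nhds (ψ.map_source hfζ))) hFc
  have hVi : ∀ i, ContinuousAt
      (fun ζ => fderiv ℂ (inCharts φ ψ f) (baseCoord ζ) (affineCoord ζ) i) ζ := fun i =>
    ContinuousAt.comp (f := fun ζ => fderiv ℂ (inCharts φ ψ f) (baseCoord ζ) (affineCoord ζ))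
      (EuclideanSpace.proj (𝕜 := ℂ) i).continuous.continuousAt hV
  have hsum : ContinuousAt (fun ζ =>
      ((∑ i, ∑ k, metricMatrix g.core ψ (inCharts φ ψ f (baseCoord ζ)) i k
        * fderiv ℂ (inCharts φ ψ f) (baseCoord ζ) (affineCoord ζ) i
        * conj (fderiv ℂ (inCharts φ ψ f) (baseCoord ζ) (affineCoord ζ) k))
        / (tautWeight h.core φ j ζ : ℂ)).re) ζ := by
    refine Complex.continuous_re.continuousAt.comp (ContinuousAt.div ?_ hw ?_)
    · refine tendsto_finsetSum _ fun i _ => tendsto_finsetSum _ fun k _ => ?_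
      exact ((hg i k).mul (hVi i)).mul (Complex.continuous_conj.continuousAt.comp (hVi k))
    · exact_mod_cast (tautWeight_pos h hφ hζ).ne'
  refine hsum.congr ?_
  filter_upwards [hbase.eventually (eventually_mem_source hf.continuous hζ hfζ)] with ξ hξ
  rw [← localRatio_mul_tautWeight g h hf hφ hψ hξ.1 hξ.2, mul_div_cancel_right₀, Complex.ofReal_re]
  exact_mod_cast (tautWeight_pos h hφ hξ.1).ne'

/-- The energy ratio attains its maximum. The projective bundle is covered by finitely many compact
sets: over a closed ball in a chart of `M`, take the lines spanned by vectors whose `j`-th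
component is `1` and whose other components are at most `1` in modulus. -/
lemma exists_forall_energyRatio_le [CompactSpace M] (g : HermitianMetric n N)
    (h : TautHermitianMetric m M)
    (hf : ContMDiff 𝓘(ℂ, EuclideanSpace ℂ (Fin m)) 𝓘(ℂ, EuclideanSpace ℂ (Fin n)) ω f)
    (hM : Nonempty M) (hm : Nonempty (Fin m)) :
    ∃ φ ∈ atlas (EuclideanSpace ℂ (Fin m)) M, ∃ (j : Fin m) (ζ : EuclideanSpace ℂ (ProjIndex j)),
      baseCoord ζ ∈ φ.target ∧
        ∀ p W, W ≠ 0 → energyRatio g h f p W ≤ localRatio g h f φ j ζ := by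
  let φ : M → OpenPartialHomeomorph M (EuclideanSpace ℂ (Fin m)) := fun p =>
    chartAt (EuclideanSpace ℂ (Fin m)) p
  have hφ : ∀ p, φ p ∈ atlas (EuclideanSpace ℂ (Fin m)) M := fun p => chart_mem_atlas _ p
  have hr : ∀ p, ∃ r > 0, Metric.closedBall (φ p p) r ⊆ (φ p).target := fun p =>
    Metric.nhds_basis_closedBall.mem_iff.1
      ((φ p).open_target.mem_nhds ((φ p).map_source (mem_chart_source _ p)))
  choose r hr0 hr using hr
  have hmax : ∀ p j, ∃ ζ : EuclideanSpace ℂ (ProjIndex j), baseCoord ζ ∈ (φ p).target ∧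
      ∀ x ∈ Metric.closedBall (φ p p) (r p) ×ˢ Metric.closedBall 0 1,
        localRatio g h f (φ p) j (projCoord j x) ≤ localRatio g h f (φ p) j ζ := fun p j => by
    have hcomp := (isCompact_closedBall (φ p p) (r p)).prod
      (isCompact_closedBall (0 : {k : Fin m // k ≠ j} → ℂ) 1)
    obtain ⟨x, hx, hxmax⟩ := hcomp.exists_isMaxOn
      (f := fun x => localRatio g h f (φ p) j (projCoord j x))
      ⟨(φ p p, 0), Metric.mem_closedBall_self (hr0 p).le, Metric.mem_closedBall_self zero_le_one⟩
      (fun x hx => (ContinuousAt.comp (f := projCoord j)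
        (continuousAt_localRatio g h hf (hφ p) (hr p hx.1))
        continuous_projCoord.continuousAt).continuousWithinAt)
    exact ⟨projCoord j x, hr p hx.1, fun x' hx' => hxmax hx'⟩
  choose ζ hζ hζmax using hmax
  obtain ⟨t, -, ht⟩ := isCompact_univ.elim_nhds_subcover
    (fun p => (φ p).source ∩ φ p ⁻¹' Metric.ball (φ p p) (r p)) (fun p _ =>
      inter_mem ((φ p).open_source.mem_nhds (mem_chart_source _ p))
        (((φ p).continuousAt (mem_chart_source _ p)).preimage_mem_nhds
          (Metric.ball_mem_nhds _ (hr0 p))))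
  have hcover : ∀ q, ∃ p ∈ t, q ∈ (φ p).source ∧ φ p q ∈ Metric.ball (φ p p) (r p) := fun q => by
    obtain ⟨p, hp, hq⟩ := Set.mem_iUnion₂.1 (ht (Set.mem_univ q))
    exact ⟨p, hp, hq⟩
  have htne : t.Nonempty := by
    obtain ⟨p, hp, -⟩ := hcover hM.some
    exact ⟨p, hp⟩
  obtain ⟨⟨p, j⟩, -, hpj⟩ := (t ×ˢ Finset.univ).exists_max_image
    (fun x : M × Fin m => localRatio g h f (φ x.1) x.2 (ζ x.1 x.2))
    (htne.product Finset.univ_nonempty)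
  refine ⟨φ p, hφ p, j, ζ p j, hζ p j, fun q W hW => ?_⟩
  obtain ⟨p', hp', hq, hqr⟩ := hcover q
  obtain ⟨z, hz, rfl⟩ : ∃ z ∈ (φ p').target, (φ p').symm z = q :=
    ⟨φ p' q, (φ p').map_source hq, (φ p').left_inv hq⟩
  rw [(φ p').right_inv hz] at hqr
  obtain ⟨w, rfl⟩ := (bijective_coordVector (hφ p') hz).2 W
  have hw : w ≠ 0 := (coordVector_eq_zero_iff (hφ p') hz).not.1 hW
  obtain ⟨i, -, hi⟩ := Finset.univ.exists_max_image (fun k => ‖w k‖) Finset.univ_nonempty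
  have hwi : w i ≠ 0 := fun h0 => hw <| by
    ext k
    have := hi k (Finset.mem_univ k)
    rw [h0, norm_zero] at this
    simpa using this
  have hwi' : ((w i)⁻¹ • w) i = 1 := by simp [hwi]
  have hmem : (z, fun k : {k : Fin m // k ≠ i} => ((w i)⁻¹ • w) k)
      ∈ Metric.closedBall (φ p' p') (r p') ×ˢ Metric.closedBall 0 1 := by
    refine ⟨Metric.ball_subset_closedBall hqr, ?_⟩
    rw [mem_closedBall_zero_iff, pi_norm_le_iff_of_nonneg zero_le_one]
    intro k
    have := hi k (Finset.mem_univ _)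
    simpa [inv_mul_le_iff₀ (norm_pos_iff.2 hwi)] using this
  have h1 := hζmax p' i _ hmem
  rw [localRatio, baseCoord_projCoord, affineCoord_projCoord hwi', coordVector_smul] at h1
  have h2 := energyRatio_smul g h f ((φ p').symm z) (inv_ne_zero hwi) (coordVector (φ p') z w)
  exact (h2.symm.le.trans h1).trans (hpj (p', i) (by simp [hp']))

end Ratio

/-! ### The contradiction at a maximum -/

lemma hasDerivAt_of_analyticAt {E : Type*} [NormedAddCommGroup E] [NormedSpace ℂ E]
    [CompleteSpace E] {y : ℂ → E} {t : ℂ} (hy : AnalyticAt ℂ y t) :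
    (∀ᶠ s in 𝓝 t, HasDerivAt y (deriv y s) s) ∧ HasDerivAt (deriv y) (deriv (deriv y) t) t :=
  ⟨hy.eventually_analyticAt.mono fun _ hs => hs.differentiableAt.hasDerivAt,
    hy.deriv.differentiableAt.hasDerivAt⟩

/-- A matrix with a positive eigenvalue is positive on the conjugate of an eigenvector. -/
lemma exists_pos_of_hasEigenvalue {ι : Type*} [Fintype ι] [DecidableEq ι] {A : Matrix ι ι ℂ}
    {μ : ℝ} (hμ : 0 < μ) (h : Module.End.HasEigenvalue (Matrix.toLin' A) (μ : ℂ)) :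
    ∃ ξ : ι → ℂ, 0 < (∑ a, ∑ b, A a b * ξ a * conj (ξ b)).re := by
  obtain ⟨x, hx⟩ := h.exists_hasEigenvector
  refine ⟨star x, ?_⟩
  have hAx : A *ᵥ x = (μ : ℂ) • x := hx.apply_eq_smul
  rw [sum_sum_eq_dotProduct, star_star, hAx, dotProduct_smul, smul_eq_mul, Complex.re_ofReal_mul]
  refine mul_pos hμ ?_
  have hsum : star x ⬝ᵥ x = ((∑ i, Complex.normSq (x i) : ℝ) : ℂ) := by
    simp [dotProduct, Complex.normSq_eq_conj_mul_self]
  rw [hsum, Complex.ofReal_re]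
  obtain ⟨i, hi⟩ := Function.ne_iff.1 hx.2
  exact Finset.sum_pos' (fun i _ => Complex.normSq_nonneg _)
    ⟨i, Finset.mem_univ i, Complex.normSq_pos.2 hi⟩

/-- If `p = G e^{-ψ}` has a positive local maximum at `t` and `G ∂∂̄G - ∂G ∂̄G ≥ 0` there, then
`∂∂̄ψ ≥ 0` at `t`. -/
lemma re_nonneg_of_isLocalMax_mul_exp {p : ℂ → ℝ} {G ψ a b a' b' : ℂ → ℂ} {c d c' d' t : ℂ}
    (hmax : IsLocalMax p t) (hpos : 0 < p t) (hψt : (ψ t).im = 0)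
    (hp : ∀ᶠ s in 𝓝 t, (p s : ℂ) = G s * Complex.exp (-ψ s))
    (hG : ∀ᶠ s in 𝓝 t, HasWirtingerAt G (a s) (b s) s) (hGb : HasWirtingerAt b c d t)
    (hψ : ∀ᶠ s in 𝓝 t, HasWirtingerAt ψ (a' s) (b' s) s) (hψb : HasWirtingerAt b' c' d' t)
    (hlog : 0 ≤ (G t * c - a t * b t).re) : 0 ≤ c'.re := by
  have hexp : ∀ s, HasWirtingerAt ψ (a' s) (b' s) s → HasWirtingerAt (fun s => Complex.exp (-ψ s))
      (-Complex.exp (-ψ s) * a' s) (-Complex.exp (-ψ s) * b' s) s := fun s hs =>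
    HasWirtingerAt.holomorphic_comp (Φ := fun w => Complex.exp (-w))
      (by simpa using (hasDerivAt_neg (ψ s)).cexp) hs
  have h1 : ∀ᶠ s in 𝓝 t, HasWirtingerAt (fun s => (p s : ℂ))
      ((a s + G s * (-1 * a' s)) * Complex.exp (-ψ s))
      ((b s + G s * (-1 * b' s)) * Complex.exp (-ψ s)) s := by
    filter_upwards [hp.eventually_nhds, hG, hψ] with s hs hGs hψs
    exact ((hGs.mul (hexp s hψs)).congr_of_eventuallyEq hs).congr_wirtinger (by ring) (by ring)
  have hconst := hasWirtingerAt_of_hasDerivAt (hasDerivAt_const t (-1 : ℂ))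
  obtain ⟨ha0, hb0, hc⟩ := wirtinger_of_isLocalMax hmax h1
    ((hGb.add (hG.self_of_nhds.mul (hconst.mul hψb))).mul (hexp t hψ.self_of_nhds))
  -- As `∂p = ∂̄p = 0` at `t`, the logarithmic derivatives of `G` are those of `e^ψ`; then
  -- `G e^ψ ∂∂̄p = G ∂∂̄G - ∂G ∂̄G - G² ∂∂̄ψ`.
  have hE : Complex.exp (-ψ t) ≠ 0 := Complex.exp_ne_zero _
  have ha : a t = G t * a' t := by
    linear_combination (mul_eq_zero.1 ha0).resolve_right hE
  have hb : b t = G t * b' t := by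
    linear_combination (mul_eq_zero.1 hb0).resolve_right hE
  have hψr : ψ t = ((ψ t).re : ℂ) := Complex.ext rfl hψt
  have hEr : Complex.exp (-ψ t) = (Real.exp (-(ψ t).re) : ℂ) := by
    rw [hψr]
    simp
  have hGr : G t = ((p t * Real.exp (ψ t).re : ℝ) : ℂ) := by
    rw [Complex.ofReal_mul, hp.self_of_nhds, Complex.ofReal_exp, ← hψr, mul_assoc,
      ← Complex.exp_add]
    simp
  have hGpos : 0 < p t * Real.exp (ψ t).re := by positivity
  rw [hEr, ha, hb] at hc
  rw [ha, hb] at hlog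
  rw [hGr] at hc hlog
  generalize p t * Real.exp (ψ t).re = r at *
  have hepos := Real.exp_pos (-(ψ t).re)
  generalize Real.exp (-(ψ t).re) = e at *
  have e1 : ((c - r * a' t * b' t - r * c').re) * e ≤ 0 := by
    have : ∀ z : ℂ, (z * e).re = z.re * e := fun z => Complex.re_mul_ofReal z e
    rw [← this]
    refine le_of_eq_of_le (congrArg Complex.re ?_) hc
    ring
  have e2 : 0 ≤ r * (c - r * a' t * b' t).re := by
    rw [← Complex.re_ofReal_mul]
    refine le_of_le_of_eq hlog (congrArg Complex.re ?_)
    ring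
  have e3 := nonneg_of_mul_nonneg_right e2 hGpos
  have e4 : (c - r * a' t * b' t - r * c').re ≤ 0 := by
    by_contra! h0
    exact absurd e1 (not_le.2 (mul_pos h0 hepos))
  rw [Complex.sub_re, Complex.re_ofReal_mul] at e4
  exact nonneg_of_mul_nonneg_right (e3.trans (sub_nonpos.1 e4)) hGpos

/-- Under RC-positivity and non-positive bisectional curvature the energy ratio has no positive
maximum, hence no positive value. -/
lemma energyRatio_nonpos {m n : ℕ}
    {M : Type*} [TopologicalSpace M] [ChartedSpace (EuclideanSpace ℂ (Fin m)) M]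
    [IsManifold 𝓘(ℂ, EuclideanSpace ℂ (Fin m)) ω M] [CompactSpace M]
    {N : Type*} [TopologicalSpace N] [ChartedSpace (EuclideanSpace ℂ (Fin n)) N]
    [IsManifold 𝓘(ℂ, EuclideanSpace ℂ (Fin n)) ω N] {f : M → N}
    (hf : ContMDiff 𝓘(ℂ, EuclideanSpace ℂ (Fin m)) 𝓘(ℂ, EuclideanSpace ℂ (Fin n)) ω f)
    (h : TautHermitianMetric m M)
    (hh : ∀ φ ∈ atlas (EuclideanSpace ℂ (Fin m)) M, ∀ (j : Fin m)
      (ζ : EuclideanSpace ℂ (ProjIndex j)), baseCoord ζ ∈ φ.target →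
        ∃ μ : ℝ, 0 < μ ∧
          Module.End.HasEigenvalue (Matrix.toLin' (h.curvatureMatrix φ j ζ)) (μ : ℂ))
    (g : HermitianMetric n N) (hg : g.NonposBisectionalCurvature)
    (p : M) {W : EuclideanSpace ℂ (Fin m)} (hW : W ≠ 0) : energyRatio g h f p W ≤ 0 := by
  by_contra! hpos
  have hm : Nonempty (Fin m) := by
    obtain ⟨k, -⟩ : ∃ k, W k ≠ 0 := by
      by_contra! h0
      exact hW (by ext k; exact h0 k)
    exact ⟨k⟩
  obtain ⟨φ, hφ, j, ζ, hζ, hmax⟩ := exists_forall_energyRatio_le g h hf ⟨p⟩ hm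
  obtain ⟨μ, hμ, heig⟩ := hh φ hφ j ζ hζ
  obtain ⟨ξ, hξ⟩ := exists_pos_of_hasEigenvalue hμ heig
  let ψ := chartAt (EuclideanSpace ℂ (Fin n)) (f (φ.symm (baseCoord ζ)))
  have hψ : ψ ∈ atlas (EuclideanSpace ℂ (Fin n)) N := chart_mem_atlas _ _
  have hfζ : f (φ.symm (baseCoord ζ)) ∈ ψ.source := mem_chart_source _ _
  have hF := contDiffAt_inCharts hf hφ hψ hζ hfζ
  -- The complex line through the maximum in the direction `ξ`.
  let Z : ℂ → EuclideanSpace ℂ (ProjIndex j) := fun t => ζ + t • WithLp.toLp 2 ξ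
  have hZ0 : Z 0 = ζ := by simp [Z]
  have hZ : ∀ t, HasDerivAt Z (WithLp.toLp 2 ξ) t := fun t => by
    simpa only [id, one_smul] using!
      ((hasDerivAt_id t).smul_const (WithLp.toLp 2 ξ : EuclideanSpace ℂ (ProjIndex j))).const_add ζ
  have hZan : ContDiffAt ℂ ω Z 0 := by
    unfold Z
    fun_prop
  have hbase : ContDiffAt ℂ ω (fun t => baseCoord (Z t)) 0 :=
    contDiff_baseCoord.contDiffAt.comp 0 hZan
  let y : ℂ → EuclideanSpace ℂ (Fin n) := fun t => inCharts φ ψ f (baseCoord (Z t))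
  let V : ℂ → EuclideanSpace ℂ (Fin n) := fun t =>
    fderiv ℂ (inCharts φ ψ f) (baseCoord (Z t)) (affineCoord (Z t))
  have hy : AnalyticAt ℂ y 0 := ContDiffAt.analyticAt <|
    ContDiffAt.comp (g := inCharts φ ψ f) (f := fun t => baseCoord (Z t)) 0
      (by simpa only [hZ0] using hF) hbase
  have hV : AnalyticAt ℂ V 0 := ContDiffAt.analyticAt <| by
    have h1 : ContDiffAt ℂ ω (fun t => fderiv ℂ (inCharts φ ψ f) (baseCoord (Z t))) 0 :=
      ContDiffAt.comp (f := fun t => baseCoord (Z t)) 0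
        (by simpa only [hZ0] using hF.fderiv_right (m := ω) (by simp)) hbase
    exact h1.clm_apply (contDiff_affineCoord.contDiffAt.comp 0 hZan)
  obtain ⟨hy1, hy2⟩ := hasDerivAt_of_analyticAt hy
  obtain ⟨hV1, hV2⟩ := hasDerivAt_of_analyticAt hV
  have hy0 : y 0 = inCharts φ ψ f (baseCoord ζ) := by simp only [y, hZ0]
  have hy0t : y 0 ∈ ψ.target := hy0 ▸ ψ.map_source hfζ
  obtain ⟨a, b, c, d, hG1, hG2, hlog⟩ := exists_wirtinger_curveNormSq
    (A := metricMatrix g.core ψ) (y := y) (V := V)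
    (fun i k => ((g.smooth ψ hψ i k).contDiffAt (ψ.open_target.mem_nhds hy0t)).of_le
      ENat.LEInfty.out)
    (Eventually.of_forall fun z => metricMatrix_isHermitian g ψ z)
    (metricMatrix_pos g hψ hy0t) (hg ψ hψ (y 0) hy0t) hy1 hy2 hV1 hV2
  -- The weight `log h(s, s)` along the line.
  have hopen : IsOpen {ζ : EuclideanSpace ℂ (ProjIndex j) | baseCoord ζ ∈ φ.target} :=
    φ.open_target.preimage contDiff_baseCoord.continuous
  have hlogw : ContDiffAt ℝ 2 (fun ξ => (Real.log (tautWeight h.core φ j ξ) : ℂ)) (Z 0) := by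
    have h1 : ContDiffAt ℝ 2 (tautWeight h.core φ j) (Z 0) := by
      rw [hZ0]
      exact ((h.smooth φ hφ j).contDiffAt (hopen.mem_nhds hζ)).of_le ENat.LEInfty.out
    have h2 := h1.log (by rw [hZ0]; exact (tautWeight_pos h hφ hζ).ne')
    exact Complex.ofRealCLM.contDiff.contDiffAt.comp (Z 0) h2
  have hψ1 := eventually_hasWirtingerAt_comp_curve hlogw (Eventually.of_forall hZ)
  obtain ⟨d', hψ2⟩ := hasWirtingerAt_wirtingerBar_comp_curve hlogw (hZ 0)
    (hasDerivAt_const 0 (WithLp.toLp 2 ξ))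
  have hev : ∀ᶠ t in 𝓝 (0 : ℂ),
      baseCoord (Z t) ∈ φ.target ∧ f (φ.symm (baseCoord (Z t))) ∈ ψ.source := by
    have := hbase.continuousAt.eventually
      (by simpa only [hZ0] using eventually_mem_source hf.continuous hζ hfζ)
    exact this
  have hfinal := re_nonneg_of_isLocalMax_mul_exp (p := fun t => localRatio g h f φ j (Z t))
    (G := curveNormSq (metricMatrix g.core ψ) y V) (t := 0)
    (ψ := fun t => (Real.log (tautWeight h.core φ j (Z t)) : ℂ)) ?_ ?_ (Complex.ofReal_im _) ?_
    hG1 hG2 hψ1 hψ2 hlog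
  · have hneg : (∑ k, ∑ l, wirtinger k (wirtingerBar l fun ξ =>
        (Real.log (tautWeight h.core φ j ξ) : ℂ)) (Z 0) * ξ k * conj (ξ l)).re < 0 := by
      rw [hZ0, ← neg_pos, ← Complex.neg_re]
      simpa only [TautHermitianMetric.curvatureMatrix, Matrix.of_apply, neg_mul,
        Finset.sum_neg_distrib] using hξ
    exact absurd hfinal (not_le.2 hneg)
  · filter_upwards [hev] with t ht
    rw [hZ0]
    exact hmax _ _ ((coordVector_eq_zero_iff hφ ht.1).not.2 (affineCoord_ne_zero _))
  · simp only [hZ0]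
    exact hpos.trans_le (hmax p W hW)
  · filter_upwards [hev] with t ht
    have hw := tautWeight_pos h hφ ht.1
    have hr := localRatio_mul_tautWeight g h hf hφ hψ ht.1 ht.2
    have hG : curveNormSq (metricMatrix g.core ψ) y V t
        = (localRatio g h f φ j (Z t) : ℂ) * tautWeight h.core φ j (Z t) := hr.symm
    rw [hG, Complex.exp_neg, ← Complex.ofReal_exp, Real.exp_log hw, mul_assoc, mul_inv_cancel₀,
      mul_one]
    exact_mod_cast hw.ne'

end RCPositivity

end

theorem corollary1p3 {m n : ℕ}
    {M : Type*} [TopologicalSpace M] [ChartedSpace (EuclideanSpace ℂ (Fin m)) M]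
    [IsManifold 𝓘(ℂ, EuclideanSpace ℂ (Fin m)) ω M] [CompactSpace M] [ConnectedSpace M]
    {N : Type*} [TopologicalSpace N] [ChartedSpace (EuclideanSpace ℂ (Fin n)) N]
    [IsManifold 𝓘(ℂ, EuclideanSpace ℂ (Fin n)) ω N]
    (f : M → N)
    (hf : ContMDiff 𝓘(ℂ, EuclideanSpace ℂ (Fin m)) 𝓘(ℂ, EuclideanSpace ℂ (Fin n)) ω f)
    (hM : RCPositivity.TautRCPositive m M)
    (hN : ∃ g : RCPositivity.HermitianMetric n N, g.NonposBisectionalCurvature) :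
    ∃ c : N, ∀ p : M, f p = c := by
  obtain ⟨h, hh⟩ := hM
  obtain ⟨g, hg⟩ := hN
  refine RCPositivity.isConst_of_differential_eq_zero hf fun p =>
    ContinuousLinearMap.ext fun W => ?_
  by_contra hne
  have hW : W ≠ 0 := fun h0 => hne (by rw [h0, map_zero, map_zero])
  have hle := RCPositivity.energyRatio_nonpos hf h hh g hg p hW
  exact absurd hle (not_le.2 (div_pos (g.innerSelf_re_pos (f p) hne)
    (RCPositivity.tautNormSq_pos h.core p hW)))
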